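/- **Setting.** An *admissible pair* $(\mathfrak g,P)$ consists of a finite-dimensional real Lie algebra $\mathfrak g$ with a filtration $\mathfrak g=\mathfrak g^{-\mu}\supset\dots\supset\mathfrak g^{0}\supset\dots\supset\mathfrak g^{\nu}$ by subspaces (with $\mathfrak g^i=\mathfrak g$ for $i<-\mu$ and $\mathfrak g^i=0$ for $i>\nu$) such that $[\mathfrak g^i,\mathfrak g^j]\subset\mathfrak g^{i+j}$, a Lie group $P$ with Lie algebra $\mathfrak p:=\mathfrak g^0$, and a smooth homomorphism $\mathrm{Ad}$ from $P$ to the filtration-preserving Lie algebra automorphisms of $\mathfrak g$ with derivative $\mathrm{ad}|_{\mathfrak g^0}$, such that (A) $\mathfrak g^0$ contains no non-zero ideal of $\mathfrak g$, and (B) if $A\in\mathfrak g^0$ satisfies $[A,\mathfrak g^i]\subset\mathfrak g^{i+1}$ for $i=-\mu,\dots,-1$, then $A\in\mathfrak g^1$. Let $\operatorname{gr}(\mathfrak g)=\bigoplus_i\mathfrak g^i/\mathfrak g^{i+1}$ be the associated graded Lie algebra, $\mathfrak m=\bigoplus_{i<0}\operatorname{gr}_i(\mathfrak g)$ its negative part,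 $C^k(\mathfrak m,\operatorname{gr}(\mathfrak g))_\ell$ the alternating $k$-linear maps $\mathfrak m^k\to\operatorname{gr}(\mathfrak g)$ that are homogeneous of degree $\ell$, and $\partial$ the Chevalley–Eilenberg differential. Let $L(\Lambda^2(\mathfrak g/\mathfrak p),\mathfrak g)^\ell\subset L(\Lambda^2(\mathfrak g/\mathfrak p),\mathfrak g)$ be the maps $\alpha$ with $\alpha(X,Y)\in\mathfrak g^{i+j+\ell}$ for all $X\in\mathfrak g^i$, $Y\in\mathfrak g^j$, $i,j<0$, and let $\operatorname{gr}_\ell: L(\Lambda^2(\mathfrak g/\mathfrak p),\mathfrak g)^\ell\to C^2(\mathfrak m,\operatorname{gr}(\mathfrak g))_\ell$ be the map $\operatorname{gr}_\ell(\alpha)(X+\mathfrak g^{i+1},Y+\mathfrak g^{j+1})=\alpha(X,Y)+\mathfrak g^{i+j+\ell+1}$. For a subspace $\mathcal N\subset L(\Lambda^2(\mathfrak g/\mathfrak p),\mathfrak g)$ put $\operatorname{gr}_\ell(\mathcal N):=\operatorname{gr}_\ell(\mathcal N\cap L(\Lambda^2(\mathfrak g/\mathfrak p),\mathfrak g)^\ell)$.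 A *normalization condition* is a $P$-invariant subspace $\mathcal N\subset L(\Lambda^2(\mathfrak g/\mathfrak p),\mathfrak g)$ such that for each $\ell>0$ the subspace $\operatorname{gr}_\ell(\mathcal N)$ is complementary in $C^2(\mathfrak m,\operatorname{gr}(\mathfrak g))_\ell$ to $\partial(C^1(\mathfrak m,\operatorname{gr}(\mathfrak g))_\ell)$. A *negligible submodule* is a $P$-invariant subspace $\tilde{\mathcal N}\subset\mathcal N$ such that $\operatorname{gr}_\ell(\tilde{\mathcal N})\cap\ker(\partial)=\{0\}$ for each $\ell>0$. A *Cartan geometry* $(p:\mathcal G\to M,\omega)$ of type $(\mathfrak g,P)$ is a smooth principal $P$-bundle $p:\mathcal G\to M$ with a one-form $\omega\in\Omega^1(\mathcal G,\mathfrak g)$ such that $(r^g)^*\omega=\mathrm{Ad}(g^{-1})\circ\omega$ for the principal right action $r^g$ of each $g\in P$, $\omega(\zeta_X)=X$ for the fundamental vector field $\zeta_X$ of each $X\in\mathfrak p$, and each $\omega_u:T_u\mathcal G\to\mathfrak g$ is a linear isomorphism. Its curvature is $K(\xi,\eta)=d\omega(\xi,\eta)+[\omega(\xi),\omega(\eta)]$.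 The geometry is *regular* if $\omega_u(\xi)\in\mathfrak g^i$ and $\omega_u(\eta)\in\mathfrak g^j$ always imply $K_u(\xi,\eta)\in\mathfrak g^{i+j+1}$. Its curvature function is $\kappa(u)(X,Y)=K_u(\omega_u^{-1}(X),\omega_u^{-1}(Y))$. The geometry is *normal* (of type $\mathcal N$) if $\kappa(u)\in\mathcal N$ for all $u\in\mathcal G$; in that case the *essential curvature function* $\kappa_e:\mathcal G\to\mathcal N/\tilde{\mathcal N}$ is the function induced by $\kappa$. **Proposition 4.3.** Let $(\mathfrak g,P)$ be an admissible pair, $\mathcal N$ a normalization condition for $(\mathfrak g,P)$ and $\tilde{\mathcal N}\subset\mathcal N$ a negligible submodule. Then for every regular normal Cartan geometry $(p:\mathcal G\to M,\omega)$ of type $(\mathfrak g,P)$, the essential curvature function $\kappa_e$ vanishes identically if and only if the curvature $K$ of $\omega$ vanishes identically. -/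

import Mathlib

open scoped Manifold ContDiff DirectSum
open LieModule.Cohomology

noncomputable section

lemma eq_zero_of_eq_neg_self {V : Type*} [AddCommGroup V] [Module ℝ V] {x : V} (h : x = -x) :
    x = 0 := by
  have h2 : (2 : ℝ) • x = 0 := by
    rw [two_smul]
    nth_rewrite 2 [h]
    exact add_neg_cancel x
  exact (smul_eq_zero.mp h2).resolve_left two_ne_zero

/-! ### Alternating bilinear maps -/

section Alternating

variable {V : Type*} [AddCommGroup V] [Module ℝ V]

lemma alt_skew (α : V [⋀^Fin 2]→ₗ[ℝ] V) (X Y : V) : α ![X, Y] = -α ![Y, X] := by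
  refine Eq.trans (congrArg α ?_) (α.map_swap ![Y, X] (i := 0) (j := 1) (by decide))
  ext i
  fin_cases i <;> rfl

/-- An alternating bilinear map in curried form. -/
def altToBilin (α : V [⋀^Fin 2]→ₗ[ℝ] V) : V →ₗ[ℝ] V →ₗ[ℝ] V :=
  LinearMap.mk₂ ℝ (fun X Y => α ![X, Y])
    (fun X X' Y => α.map_vecCons_add _ X X')
    (fun c X Y => α.map_vecCons_smul _ c X)
    (fun X Y Y' => by
      rw [alt_skew, α.map_vecCons_add, neg_add, ← alt_skew, ← alt_skew])
    (fun c X Y => by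
      rw [alt_skew, α.map_vecCons_smul, ← smul_neg, ← alt_skew])

lemma altToBilin_apply (α : V [⋀^Fin 2]→ₗ[ℝ] V) (X Y : V) : altToBilin α X Y = α ![X, Y] := rfl

end Alternating

/-! ### Lie algebras on finite dimensional normed spaces -/

/-- A Lie bracket on a real normed space. In finite dimensions all norms are equivalent, and the
norm only serves to make sense of smooth maps with values in the Lie algebra. -/
class LieBracketOn (𝔤 : Type*) [NormedAddCommGroup 𝔤] [NormedSpace ℝ 𝔤] extends
    Bracket 𝔤 𝔤 where
  add_lie' : ∀ x y z : 𝔤, ⁅x + y, z⁆ = ⁅x, z⁆ + ⁅y, z⁆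
  lie_add' : ∀ x y z : 𝔤, ⁅x, y + z⁆ = ⁅x, y⁆ + ⁅x, z⁆
  lie_self' : ∀ x : 𝔤, ⁅x, x⁆ = 0
  leibniz_lie' : ∀ x y z : 𝔤, ⁅x, ⁅y, z⁆⁆ = ⁅⁅x, y⁆, z⁆ + ⁅y, ⁅x, z⁆⁆
  lie_smul' : ∀ (c : ℝ) (x y : 𝔤), ⁅x, c • y⁆ = c • ⁅x, y⁆

section Algebra

variable {𝔤 : Type*} [NormedAddCommGroup 𝔤] [NormedSpace ℝ 𝔤] [LieBracketOn 𝔤]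

instance LieBracketOn.instLieRing : LieRing 𝔤 where
  add_lie := LieBracketOn.add_lie'
  lie_add := LieBracketOn.lie_add'
  lie_self := LieBracketOn.lie_self'
  leibniz_lie := LieBracketOn.leibniz_lie'

instance LieBracketOn.instLieAlgebra : LieAlgebra ℝ 𝔤 where
  lie_smul := LieBracketOn.lie_smul'

/-! ### Filtered Lie algebras and the associated graded Lie algebra -/

variable (𝔤) in
/-- A filtration `𝔤 = 𝔤^{-μ} ⊇ … ⊇ 𝔤^0 ⊇ … ⊇ 𝔤^ν ⊇ 𝔤^{ν+1} = 0` making `𝔤` a filtered Lie algebra.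
It is indexed by all integers: monotonicity forces `𝔤^i = 𝔤` for `i ≤ -μ` and `𝔤^i = 0` for
`i > ν`. -/
structure LieFiltration where
  /-- the filtration component `𝔤^i` -/
  F : ℤ → Submodule ℝ 𝔤
  anti : Antitone F
  lie_mem : ∀ {i j : ℤ} {X Y : 𝔤}, X ∈ F i → Y ∈ F j → ⁅X, Y⁆ ∈ F (i + j)
  /-- the depth -/
  μ : ℕ
  /-- the height -/
  ν : ℕ
  F_neg_depth : F (-(μ : ℤ)) = ⊤
  F_height_succ : F ((ν : ℤ) + 1) = ⊥

namespace LieFiltration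

variable (𝓕 : LieFiltration 𝔤)

/-- `gr_i(𝔤) = 𝔤^i / 𝔤^{i+1}`. -/
abbrev Piece (i : ℤ) : Type _ := 𝓕.F i ⧸ (𝓕.F (i + 1)).submoduleOf (𝓕.F i)

/-- The associated graded space `gr(𝔤) = ⨁ gr_i(𝔤)`. -/
def Gr : Type _ := ⨁ i : ℤ, 𝓕.Piece i

instance : AddCommGroup 𝓕.Gr := inferInstanceAs (AddCommGroup (⨁ i : ℤ, 𝓕.Piece i))
instance : Module ℝ 𝓕.Gr := inferInstanceAs (Module ℝ (⨁ i : ℤ, 𝓕.Piece i))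

/-- The inclusion `gr_i(𝔤) → gr(𝔤)`. -/
def incl (i : ℤ) : 𝓕.Piece i →ₗ[ℝ] 𝓕.Gr := DirectSum.lof ℝ ℤ 𝓕.Piece i

/-- The projection `gr(𝔤) → gr_i(𝔤)`. -/
def proj (i : ℤ) : 𝓕.Gr →ₗ[ℝ] 𝓕.Piece i := DirectSum.component ℝ ℤ 𝓕.Piece i

/-- The map `𝔤^i → gr_i(𝔤) ⊆ gr(𝔤)` sending `X` to `X + 𝔤^{i+1}`. -/
def sym (i : ℤ) : 𝓕.F i →ₗ[ℝ] 𝓕.Gr := 𝓕.incl i ∘ₗ Submodule.mkQ _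

lemma sym_eq_zero {i : ℤ} (X : 𝓕.F i) (h : (X : 𝔤) ∈ 𝓕.F (i + 1)) : 𝓕.sym i X = 0 := by
  have : Submodule.mkQ ((𝓕.F (i + 1)).submoduleOf (𝓕.F i)) X = 0 := by
    rw [Submodule.mkQ_apply, Submodule.Quotient.mk_eq_zero]
    exact h
  simp [sym, this]

lemma sym_congr {i j : ℤ} (h : i = j) {X : 𝓕.F i} {Y : 𝓕.F j} (hXY : (X : 𝔤) = Y) :
    𝓕.sym i X = 𝓕.sym j Y := by
  subst h
  rw [Subtype.ext hXY]

lemma linearMap_ext {M : Type*} [AddCommGroup M] [Module ℝ M] {f g : 𝓕.Gr →ₗ[ℝ] M}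
    (h : ∀ i (X : 𝓕.F i), f (𝓕.sym i X) = g (𝓕.sym i X)) : f = g := by
  refine DirectSum.linearMap_ext ℝ (fun i => ?_)
  refine Submodule.linearMap_qext _ ?_
  ext X
  exact h i X

/-- A bilinear map `b` on `𝔤` mapping `𝔤^i × 𝔤^j` to `𝔤^{i+j+ℓ}` for all `i` and `j` induces
`𝔤^i × 𝔤^j → gr_{i+j+ℓ}(𝔤)`, `(X, Y) ↦ b(X, Y) + 𝔤^{i+j+ℓ+1}`. -/
def grBilinAux (b : 𝔤 →ₗ[ℝ] 𝔤 →ₗ[ℝ] 𝔤) (ℓ : ℤ)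
    (hb : ∀ i j X Y, X ∈ 𝓕.F i → Y ∈ 𝓕.F j → b X Y ∈ 𝓕.F (i + j + ℓ)) (i j : ℤ) :
    𝓕.F i →ₗ[ℝ] 𝓕.F j →ₗ[ℝ] 𝓕.Gr :=
  LinearMap.mk₂ ℝ (fun X Y => 𝓕.sym (i + j + ℓ) ⟨b X Y, hb i j X Y X.2 Y.2⟩)
    (fun X X' Y => by rw [← map_add]; congr 1; ext; simp)
    (fun c X Y => by rw [← map_smul]; congr 1; ext; simp)
    (fun X Y Y' => by rw [← map_add]; congr 1; ext; simp)
    (fun c X Y => by rw [← map_smul]; congr 1; ext; simp)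

/-- The map `gr_i(𝔤) × gr_j(𝔤) → gr_{i+j+ℓ}(𝔤)` induced by `b` on the quotients. -/
def grBilinPiece (b : 𝔤 →ₗ[ℝ] 𝔤 →ₗ[ℝ] 𝔤) (ℓ : ℤ)
    (hb : ∀ i j X Y, X ∈ 𝓕.F i → Y ∈ 𝓕.F j → b X Y ∈ 𝓕.F (i + j + ℓ)) (i j : ℤ) :
    𝓕.Piece i →ₗ[ℝ] 𝓕.Piece j →ₗ[ℝ] 𝓕.Gr :=
  Submodule.liftQ _
    (LinearMap.flip (Submodule.liftQ _ (LinearMap.flip (𝓕.grBilinAux b ℓ hb i j)) (by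
      intro Y hY
      rw [LinearMap.mem_ker]
      ext X
      exact 𝓕.sym_eq_zero _ (by
        have := hb i (j + 1) X Y X.2 hY
        rwa [show i + (j + 1) + ℓ = i + j + ℓ + 1 by ring] at this))))
    (by
      intro X hX
      rw [LinearMap.mem_ker]
      refine Submodule.linearMap_qext _ ?_
      ext Y
      exact 𝓕.sym_eq_zero _ (by
        have := hb (i + 1) j X Y hX Y.2
        rwa [show i + 1 + j + ℓ = i + j + ℓ + 1 by ring] at this))

/-- The bilinear map on `gr(𝔤)`, homogeneous of degree `ℓ`, induced by a bilinear map on `𝔤` which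
maps `𝔤^i × 𝔤^j` to `𝔤^{i+j+ℓ}`. -/
def grBilin (b : 𝔤 →ₗ[ℝ] 𝔤 →ₗ[ℝ] 𝔤) (ℓ : ℤ)
    (hb : ∀ i j X Y, X ∈ 𝓕.F i → Y ∈ 𝓕.F j → b X Y ∈ 𝓕.F (i + j + ℓ)) :
    𝓕.Gr →ₗ[ℝ] 𝓕.Gr →ₗ[ℝ] 𝓕.Gr :=
  DirectSum.toModule ℝ ℤ _ (fun i => LinearMap.flip (DirectSum.toModule ℝ ℤ _
    (fun j => LinearMap.flip (𝓕.grBilinPiece b ℓ hb i j))))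

lemma grBilin_sym (b : 𝔤 →ₗ[ℝ] 𝔤 →ₗ[ℝ] 𝔤) (ℓ : ℤ)
    (hb : ∀ i j X Y, X ∈ 𝓕.F i → Y ∈ 𝓕.F j → b X Y ∈ 𝓕.F (i + j + ℓ))
    {i j : ℤ} (X : 𝓕.F i) (Y : 𝓕.F j) :
    𝓕.grBilin b ℓ hb (𝓕.sym i X) (𝓕.sym j Y) =
      𝓕.sym (i + j + ℓ) ⟨b X Y, hb i j X Y X.2 Y.2⟩ := by
  simp only [grBilin, sym, incl]
  erw [DirectSum.toModule_lof, LinearMap.flip_apply, DirectSum.toModule_lof]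
  rfl

lemma bilin_ext {M : Type*} [AddCommGroup M] [Module ℝ M] {f g : 𝓕.Gr →ₗ[ℝ] 𝓕.Gr →ₗ[ℝ] M}
    (h : ∀ i (X : 𝓕.F i) j (Y : 𝓕.F j),
      f (𝓕.sym i X) (𝓕.sym j Y) = g (𝓕.sym i X) (𝓕.sym j Y)) : f = g :=
  𝓕.linearMap_ext fun i X => 𝓕.linearMap_ext fun j Y => h i X j Y

/-- The bracket on `gr(𝔤)` as a bilinear map. -/
def grBracket : 𝓕.Gr →ₗ[ℝ] 𝓕.Gr →ₗ[ℝ] 𝓕.Gr :=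
  𝓕.grBilin (LieModule.toEnd ℝ 𝔤 𝔤 : 𝔤 →ₗ[ℝ] 𝔤 →ₗ[ℝ] 𝔤) 0
    (fun _ _ _ _ hX hY => by simpa using 𝓕.lie_mem hX hY)

lemma grBracket_sym {i j : ℤ} (X : 𝓕.F i) (Y : 𝓕.F j) :
    𝓕.grBracket (𝓕.sym i X) (𝓕.sym j Y) =
      𝓕.sym (i + j) ⟨⁅(X : 𝔤), (Y : 𝔤)⁆, 𝓕.lie_mem X.2 Y.2⟩ :=
  (𝓕.grBilin_sym _ _ _ X Y).trans (𝓕.sym_congr (by ring) rfl)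

lemma grBracket_skew (x y : 𝓕.Gr) : 𝓕.grBracket x y = -𝓕.grBracket y x := by
  have : 𝓕.grBracket = -LinearMap.flip 𝓕.grBracket := by
    refine 𝓕.bilin_ext fun i X j Y => ?_
    simp only [LinearMap.neg_apply, LinearMap.flip_apply]
    rw [grBracket_sym, grBracket_sym, ← map_neg]
    exact 𝓕.sym_congr (by ring) (by simp)
  exact congrArg (fun f : 𝓕.Gr →ₗ[ℝ] 𝓕.Gr →ₗ[ℝ] 𝓕.Gr => f x y) this

lemma grBracket_leibniz (x y z : 𝓕.Gr) :
    𝓕.grBracket x (𝓕.grBracket y z) =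
      𝓕.grBracket (𝓕.grBracket x y) z + 𝓕.grBracket y (𝓕.grBracket x z) := by
  let B := 𝓕.grBracket
  have h : ∀ (i : ℤ) (X : 𝓕.F i), LinearMap.compr₂ B (B (𝓕.sym i X)) =
      B ∘ₗ (B (𝓕.sym i X)) + LinearMap.compl₂ B (B (𝓕.sym i X)) := by
    intro i X
    refine 𝓕.bilin_ext fun j Y k Z => ?_
    simp only [B, LinearMap.compr₂_apply, LinearMap.add_apply, LinearMap.comp_apply,
      LinearMap.compl₂_apply, grBracket_sym]
    rw [𝓕.sym_congr (i := i + j + k) (j := i + (j + k))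
        (Y := ⟨⁅⁅(X : 𝔤), (Y : 𝔤)⁆, (Z : 𝔤)⁆,
          add_assoc i j k ▸ 𝓕.lie_mem (𝓕.lie_mem X.2 Y.2) Z.2⟩) (by ring) rfl,
      𝓕.sym_congr (i := j + (i + k)) (j := i + (j + k))
        (Y := ⟨⁅(Y : 𝔤), ⁅(X : 𝔤), (Z : 𝔤)⁆⁆,
          add_left_comm j i k ▸ 𝓕.lie_mem Y.2 (𝓕.lie_mem X.2 Z.2)⟩) (by ring) rfl,
      ← map_add]
    exact 𝓕.sym_congr rfl (by simp)
  have : LinearMap.flip B (B y z) =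
      LinearMap.flip B z ∘ₗ LinearMap.flip B y + B y ∘ₗ LinearMap.flip B z := by
    refine 𝓕.linearMap_ext fun i X => ?_
    exact congrArg (fun f : 𝓕.Gr →ₗ[ℝ] 𝓕.Gr →ₗ[ℝ] 𝓕.Gr => f y z) (h i X)
  exact congrArg (fun f : 𝓕.Gr →ₗ[ℝ] 𝓕.Gr => f x) this

/-- The graded Lie algebra structure on `gr(𝔤)`, determined by
`[X + 𝔤^{i+1}, Y + 𝔤^{j+1}] = [X, Y] + 𝔤^{i+j+1}`. -/
instance instLieRingGr : LieRing 𝓕.Gr where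
  bracket x y := 𝓕.grBracket x y
  add_lie x y z := by simp
  lie_add x y z := by simp
  lie_self x := by
    have h := 𝓕.grBracket_skew x x
    exact eq_zero_of_eq_neg_self h
  leibniz_lie := 𝓕.grBracket_leibniz

instance instLieAlgebraGr : LieAlgebra ℝ 𝓕.Gr where
  lie_smul c x y := (𝓕.grBracket x).map_smul c y

lemma lie_sym {i j : ℤ} (X : 𝓕.F i) (Y : 𝓕.F j) :
    ⁅𝓕.sym i X, 𝓕.sym j Y⁆ = 𝓕.sym (i + j) ⟨⁅(X : 𝔤), (Y : 𝔤)⁆, 𝓕.lie_mem X.2 Y.2⟩ :=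
  𝓕.grBracket_sym X Y

lemma proj_sym_of_ne {i k : ℤ} (h : i ≠ k) (X : 𝓕.F i) : 𝓕.proj k (𝓕.sym i X) = 0 := by
  have := DirectSum.component.of ℝ (M := 𝓕.Piece) k i (Submodule.Quotient.mk X)
  simp only [h, dite_false] at this
  exact this

lemma gr_eq_sum (x : 𝓕.Gr) : ∃ s : Finset ℤ, (∀ i ∈ s, 𝓕.proj i x ≠ 0) ∧
    x = ∑ i ∈ s, 𝓕.incl i (𝓕.proj i x) := by
  classical
  refine ⟨DFinsupp.support (β := 𝓕.Piece) x, fun i hi => ?_,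
    (DirectSum.sum_support_of (β := 𝓕.Piece) x).symm⟩
  exact DFinsupp.mem_support_iff.mp hi

lemma incl_eq_sym (i : ℤ) (q : 𝓕.Piece i) : ∃ X : 𝓕.F i, 𝓕.incl i q = 𝓕.sym i X := by
  obtain ⟨X, rfl⟩ := Submodule.mkQ_surjective _ q
  exact ⟨X, rfl⟩

/-- The negative part `𝔪 = ⨁_{i<0} gr_i(𝔤)` as a Lie subalgebra of `gr(𝔤)`. -/
def negPart : LieSubalgebra ℝ 𝓕.Gr where
  carrier := {x | ∀ i, 0 ≤ i → 𝓕.proj i x = 0}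
  add_mem' := fun {x y} hx hy i hi => by rw [map_add, hx i hi, hy i hi, add_zero]
  zero_mem' := fun i _ => map_zero _
  smul_mem' := fun c x hx i hi => by rw [map_smul, hx i hi, smul_zero]
  lie_mem' := by
    intro x y hx hy k hk
    obtain ⟨s, hs, hxs⟩ := 𝓕.gr_eq_sum x
    obtain ⟨t, ht, hyt⟩ := 𝓕.gr_eq_sum y
    rw [hxs, hyt]
    simp only [sum_lie, lie_sum, map_sum]
    refine Finset.sum_eq_zero fun j hj => Finset.sum_eq_zero fun i hi => ?_
    have hi0 : i < 0 := by
      by_contra h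
      exact hs i hi (hx i (not_lt.mp h))
    have hj0 : j < 0 := by
      by_contra h
      exact ht j hj (hy j (not_lt.mp h))
    obtain ⟨X, hX⟩ := 𝓕.incl_eq_sym i (𝓕.proj i x)
    obtain ⟨Y, hY⟩ := 𝓕.incl_eq_sym j (𝓕.proj j y)
    rw [hX, hY, lie_sym]
    exact 𝓕.proj_sym_of_ne (by omega) _

/-! ### Cochains -/

/-- The subspace `gr_i(𝔤)` of `gr(𝔤)`. -/
def grSub (i : ℤ) : Submodule ℝ 𝓕.Gr := LinearMap.range (𝓕.incl i)

/-- `C¹(𝔪, gr(𝔤))_ℓ`: linear maps `𝔪 → gr(𝔤)` which are homogeneous of degree `ℓ`. -/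
def oneCochainDeg (ℓ : ℤ) : Submodule ℝ (oneCochain ℝ 𝓕.negPart 𝓕.Gr) where
  carrier := {φ | ∀ i < 0, ∀ x : 𝓕.negPart, (x : 𝓕.Gr) ∈ 𝓕.grSub i → φ x ∈ 𝓕.grSub (i + ℓ)}
  add_mem' := fun hφ hψ i hi x hx => add_mem (hφ i hi x hx) (hψ i hi x hx)
  zero_mem' := fun _ _ _ _ => zero_mem _
  smul_mem' := fun c _ hφ i hi x hx => Submodule.smul_mem _ c (hφ i hi x hx)

/-- `C²(𝔪, gr(𝔤))_ℓ`: alternating bilinear maps `𝔪 × 𝔪 → gr(𝔤)` which are homogeneous of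
degree `ℓ`. -/
def twoCochainDeg (ℓ : ℤ) : Submodule ℝ (twoCochain ℝ 𝓕.negPart 𝓕.Gr) where
  carrier := {φ | ∀ i < 0, ∀ j < 0, ∀ x y : 𝓕.negPart, (x : 𝓕.Gr) ∈ 𝓕.grSub i →
    (y : 𝓕.Gr) ∈ 𝓕.grSub j → φ x y ∈ 𝓕.grSub (i + j + ℓ)}
  add_mem' := fun hφ hψ i hi j hj x y hx hy =>
    add_mem (hφ i hi j hj x y hx hy) (hψ i hi j hj x y hx hy)
  zero_mem' := fun _ _ _ _ _ _ _ _ => zero_mem _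
  smul_mem' := fun c _ hφ i hi j hj x y hx hy =>
    Submodule.smul_mem _ c (hφ i hi j hj x y hx hy)

/-- `L(Λ²(𝔤/𝔭), 𝔤)` with `𝔭 = 𝔤^0`, viewed as the space of alternating bilinear maps
`𝔤 × 𝔤 → 𝔤` which vanish if one of their entries lies in `𝔭`. -/
def horCochain : Submodule ℝ (𝔤 [⋀^Fin 2]→ₗ[ℝ] 𝔤) where
  carrier := {α | ∀ X ∈ 𝓕.F 0, ∀ Y, α ![X, Y] = 0}
  add_mem' := fun hα hβ X hX Y => by
    rw [AlternatingMap.add_apply, hα X hX Y, hβ X hX Y, add_zero]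
  zero_mem' := fun _ _ _ => rfl
  smul_mem' := fun c _ hα X hX Y => by rw [AlternatingMap.smul_apply, hα X hX Y, smul_zero]

/-- `L(Λ²(𝔤/𝔭), 𝔤)^ℓ`: the maps which are homogeneous of degree `≥ ℓ`. -/
def horCochainGE (ℓ : ℤ) : Submodule ℝ (𝔤 [⋀^Fin 2]→ₗ[ℝ] 𝔤) where
  carrier := {α | α ∈ 𝓕.horCochain ∧ ∀ i < 0, ∀ j < 0, ∀ X ∈ 𝓕.F i, ∀ Y ∈ 𝓕.F j,
    α ![X, Y] ∈ 𝓕.F (i + j + ℓ)}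
  add_mem' := fun hα hβ => ⟨add_mem hα.1 hβ.1, fun i hi j hj X hX Y hY =>
    add_mem (hα.2 i hi j hj X hX Y hY) (hβ.2 i hi j hj X hX Y hY)⟩
  zero_mem' := ⟨zero_mem _, fun _ _ _ _ _ _ _ _ => zero_mem _⟩
  smul_mem' := fun c _ hα => ⟨Submodule.smul_mem _ c hα.1, fun i hi j hj X hX Y hY =>
    Submodule.smul_mem _ c (hα.2 i hi j hj X hX Y hY)⟩

variable {𝓕} in
lemma horCochainGE_mem {ℓ : ℤ} {α : 𝔤 [⋀^Fin 2]→ₗ[ℝ] 𝔤} (hα : α ∈ 𝓕.horCochainGE ℓ) (i j : ℤ)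
    (X Y : 𝔤) (hX : X ∈ 𝓕.F i) (hY : Y ∈ 𝓕.F j) : altToBilin α X Y ∈ 𝓕.F (i + j + ℓ) := by
  rw [altToBilin_apply]
  by_cases hi : i < 0
  · by_cases hj : j < 0
    · exact hα.2 i hi j hj X hX Y hY
    · rw [alt_skew, hα.1 Y (𝓕.anti (not_lt.mp hj) hY) X, neg_zero]
      exact zero_mem _
  · rw [hα.1 X (𝓕.anti (not_lt.mp hi) hX) Y]
    exact zero_mem _

/-- The map `gr_ℓ : L(Λ²(𝔤/𝔭), 𝔤)^ℓ → C²(𝔪, gr(𝔤))`, determined by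
`gr_ℓ(α)(X + 𝔤^{i+1}, Y + 𝔤^{j+1}) = α(X, Y) + 𝔤^{i+j+ℓ+1}`. -/
def grMap (ℓ : ℤ) : 𝓕.horCochainGE ℓ →ₗ[ℝ] twoCochain ℝ 𝓕.negPart 𝓕.Gr where
  toFun α := ⟨(𝓕.grBilin (altToBilin α.1) ℓ (horCochainGE_mem α.2)).compl₁₂
      (𝓕.negPart.toSubmodule.subtype) (𝓕.negPart.toSubmodule.subtype), by
    have h : 𝓕.grBilin (altToBilin α.1) ℓ (horCochainGE_mem α.2) =
        -LinearMap.flip (𝓕.grBilin (altToBilin α.1) ℓ (horCochainGE_mem α.2)) := by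
      refine 𝓕.bilin_ext fun i X j Y => ?_
      simp only [LinearMap.neg_apply, LinearMap.flip_apply]
      rw [grBilin_sym, grBilin_sym, ← map_neg]
      exact 𝓕.sym_congr (by ring) (alt_skew α.1 (X : 𝔤) (Y : 𝔤))
    intro x
    have h2 := congrArg (fun f : 𝓕.Gr →ₗ[ℝ] 𝓕.Gr →ₗ[ℝ] 𝓕.Gr => f x x) h
    exact eq_zero_of_eq_neg_self h2⟩
  map_add' α β := by
    have h : 𝓕.grBilin (altToBilin (α + β).1) ℓ (horCochainGE_mem (α + β).2) =
        𝓕.grBilin (altToBilin α.1) ℓ (horCochainGE_mem α.2) + 𝓕.grBilin (altToBilin β.1) ℓ (horCochainGE_mem β.2) := by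
      refine 𝓕.bilin_ext fun i X j Y => ?_
      simp only [LinearMap.add_apply]
      rw [grBilin_sym, grBilin_sym, grBilin_sym, ← map_add]
      rfl
    ext x y
    exact congrArg (fun f : 𝓕.Gr →ₗ[ℝ] 𝓕.Gr →ₗ[ℝ] 𝓕.Gr => f x y) h
  map_smul' c α := by
    have h : 𝓕.grBilin (altToBilin (c • α).1) ℓ (horCochainGE_mem (c • α).2) =
        c • 𝓕.grBilin (altToBilin α.1) ℓ (horCochainGE_mem α.2) := by
      refine 𝓕.bilin_ext fun i X j Y => ?_
      simp only [LinearMap.smul_apply]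
      rw [grBilin_sym, grBilin_sym, ← map_smul]
      rfl
    ext x y
    exact congrArg (fun f : 𝓕.Gr →ₗ[ℝ] 𝓕.Gr →ₗ[ℝ] 𝓕.Gr => f x y) h

/-- `gr_ℓ(N) ⊆ C²(𝔪, gr(𝔤))` for a subspace `N ⊆ L(Λ²(𝔤/𝔭), 𝔤)`: the image under `gr_ℓ` of the
filtration component `N ∩ L(Λ²(𝔤/𝔭), 𝔤)^ℓ`. -/
def grOf (ℓ : ℤ) (N : Submodule ℝ (𝔤 [⋀^Fin 2]→ₗ[ℝ] 𝔤)) :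
    Submodule ℝ (twoCochain ℝ 𝓕.negPart 𝓕.Gr) :=
  (N.submoduleOf (𝓕.horCochainGE ℓ)).map (𝓕.grMap ℓ)

end LieFiltration

end Algebra

/-! ### Admissible pairs, normalization conditions and negligible submodules -/

section Pairs

variable (𝔤 : Type*) [NormedAddCommGroup 𝔤] [NormedSpace ℝ 𝔤] [LieBracketOn 𝔤]
  {EP : Type*} [NormedAddCommGroup EP] [NormedSpace ℝ EP]
  (P : Type*) [TopologicalSpace P] [ChartedSpace EP P] [Group P]

/-- The data and conditions which make a filtered Lie algebra `𝔤` and a Lie group `P` (modelled on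
`EP`) into an admissible pair. -/
structure AdmissiblePair extends LieFiltration 𝔤 where
  /-- the identification of the Lie algebra of `P` with `𝔭 = 𝔤^0` -/
  lieIso : GroupLieAlgebra 𝓘(ℝ, EP) P ≃ₗ[ℝ] F 0
  lieIso_lie : ∀ v w : GroupLieAlgebra 𝓘(ℝ, EP) P,
    ((lieIso ⁅v, w⁆ : F 0) : 𝔤) = ⁅(lieIso v : 𝔤), (lieIso w : 𝔤)⁆
  /-- the homomorphism from `P` to the filtration preserving automorphisms of `𝔤`; the values are
  automatically invertible, since `P` is a group -/
  Ad : P →* (𝔤 →L[ℝ] 𝔤)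
  Ad_lie : ∀ (g : P) (X Y : 𝔤), Ad g ⁅X, Y⁆ = ⁅Ad g X, Ad g Y⁆
  Ad_mem : ∀ (g : P) (i : ℤ) (X : 𝔤), X ∈ F i → Ad g X ∈ F i
  Ad_contMDiff : ContMDiff 𝓘(ℝ, EP) 𝓘(ℝ, 𝔤 →L[ℝ] 𝔤) ∞ Ad
  /-- the derivative of `Ad` at the neutral element is `ad` restricted to `𝔤^0` -/
  Ad_deriv : ∀ (v : GroupLieAlgebra 𝓘(ℝ, EP) P) (X : 𝔤),
    (show 𝔤 →L[ℝ] 𝔤 from mfderiv 𝓘(ℝ, EP) 𝓘(ℝ, 𝔤 →L[ℝ] 𝔤) Ad 1 v) X = ⁅(lieIso v : 𝔤), X⁆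
  /-- infinitesimal effectivity: no non-zero ideal of `𝔤` is contained in `𝔤^0` -/
  effective : ∀ I : LieIdeal ℝ 𝔤, (∀ X ∈ I, X ∈ F 0) → I = ⊥
  /-- elements of `𝔤^0` whose adjoint action raises the negative filtration degrees lie in `𝔤^1` -/
  mem_one : ∀ A ∈ F 0,
    (∀ i : ℤ, -(μ : ℤ) ≤ i → i ≤ -1 → ∀ X ∈ F i, ⁅A, X⁆ ∈ F (i + 1)) → A ∈ F 1

namespace AdmissiblePair

variable {𝔤 P} (A : AdmissiblePair 𝔤 P (EP := EP))

/-- The action of `g ∈ P` on alternating bilinear maps `𝔤 × 𝔤 → 𝔤`: `(g · α)(X, Y) = Ad(g)(α(Ad(g⁻¹)X, Ad(g⁻¹)Y))`. -/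
def act (g : P) (α : 𝔤 [⋀^Fin 2]→ₗ[ℝ] 𝔤) : 𝔤 [⋀^Fin 2]→ₗ[ℝ] 𝔤 :=
  (A.Ad g : 𝔤 →ₗ[ℝ] 𝔤).compAlternatingMap (α.compLinearMap (A.Ad g⁻¹ : 𝔤 →ₗ[ℝ] 𝔤))

lemma act_apply (g : P) (α : 𝔤 [⋀^Fin 2]→ₗ[ℝ] 𝔤) (X Y : 𝔤) :
    A.act g α ![X, Y] = A.Ad g (α ![A.Ad g⁻¹ X, A.Ad g⁻¹ Y]) := by
  have h : (fun i => (A.Ad g⁻¹ : 𝔤 →ₗ[ℝ] 𝔤) (![X, Y] i)) = ![A.Ad g⁻¹ X, A.Ad g⁻¹ Y] := by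
    ext i
    fin_cases i <;> rfl
  exact congrArg (fun v => A.Ad g (α v)) h

/-- A normalization condition: a `P`-invariant subspace `N` of `L(Λ²(𝔤/𝔭), 𝔤)` such that for each
`ℓ > 0` the subspace `gr_ℓ(N)` of `C²(𝔪, gr(𝔤))_ℓ` is complementary to the image of
`∂ : C¹(𝔪, gr(𝔤))_ℓ → C²(𝔪, gr(𝔤))_ℓ`. -/
structure IsNormalizationCondition (N : Submodule ℝ (𝔤 [⋀^Fin 2]→ₗ[ℝ] 𝔤)) : Prop where
  le_hor : N ≤ A.horCochain
  invariant : ∀ (g : P), ∀ α ∈ N, A.act g α ∈ N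
  disjoint : ∀ ℓ : ℤ, 0 < ℓ → A.grOf ℓ N ⊓
    (A.oneCochainDeg ℓ).map (d₁₂ ℝ A.negPart A.Gr) = ⊥
  sup_eq : ∀ ℓ : ℤ, 0 < ℓ → A.grOf ℓ N ⊔
    (A.oneCochainDeg ℓ).map (d₁₂ ℝ A.negPart A.Gr) = A.twoCochainDeg ℓ

/-- A negligible submodule of `N`: a `P`-invariant subspace `N'` of `N` such that for each `ℓ > 0`
the subspace `gr_ℓ(N')` meets the kernel of `∂` on 2-cochains only in zero. -/
structure IsNegligible (N N' : Submodule ℝ (𝔤 [⋀^Fin 2]→ₗ[ℝ] 𝔤)) : Prop where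
  le : N' ≤ N
  invariant : ∀ (g : P), ∀ α ∈ N', A.act g α ∈ N'
  disjoint : ∀ ℓ : ℤ, 0 < ℓ → A.grOf ℓ N' ⊓ twoCocycle ℝ A.negPart A.Gr = ⊥

end AdmissiblePair

end Pairs

/-! ### Principal bundles -/

section Bundles

variable {EP : Type*} [NormedAddCommGroup EP] [NormedSpace ℝ EP]
  (P : Type*) [TopologicalSpace P] [ChartedSpace EP P] [Group P]
  {EG : Type*} [NormedAddCommGroup EG] [NormedSpace ℝ EG]
  (G : Type*) [TopologicalSpace G] [ChartedSpace EG G]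
  {EM : Type*} [NormedAddCommGroup EM] [NormedSpace ℝ EM]
  (M : Type*) [TopologicalSpace M] [ChartedSpace EM M]

/-- A smooth principal bundle `p : G → M` with structure group `P`. -/
structure PrincipalBundle where
  /-- the bundle projection -/
  p : G → M
  /-- the principal right action -/
  act : G → P → G
  act_one : ∀ u, act u 1 = u
  act_mul : ∀ u g h, act u (g * h) = act (act u g) h
  p_act : ∀ u g, p (act u g) = p u
  contMDiff_p : ContMDiff 𝓘(ℝ, EG) 𝓘(ℝ, EM) ∞ p
  contMDiff_act : ContMDiff (𝓘(ℝ, EG).prod 𝓘(ℝ, EP)) 𝓘(ℝ, EG) ∞ (fun q : G × P => act q.1 q.2)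
  /-- around each point of `M` there is a smooth local trivialization `p⁻¹(U) ≅ U × P` which
  intertwines the principal right action with right multiplication in `P` -/
  exists_trivialization : ∀ x : M, ∃ e : Bundle.Trivialization P p, x ∈ e.baseSet ∧
    ContMDiffOn 𝓘(ℝ, EG) (𝓘(ℝ, EM).prod 𝓘(ℝ, EP)) ∞ e e.source ∧
    ContMDiffOn (𝓘(ℝ, EM).prod 𝓘(ℝ, EP)) 𝓘(ℝ, EG) ∞ e.toOpenPartialHomeomorph.symm e.target ∧
    ∀ u ∈ e.source, ∀ g : P, e (act u g) = ((e u).1, (e u).2 * g)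

end Bundles

/-! ### Vector valued one-forms and their exterior derivative -/

section Forms

variable {EG : Type*} [NormedAddCommGroup EG] [NormedSpace ℝ EG]
  {G : Type*} [TopologicalSpace G] [ChartedSpace EG G]
  {V : Type*} [NormedAddCommGroup V] [NormedSpace ℝ V]

/-- The exterior derivative of a one-form on a vector space is the alternation of its
derivative. -/
lemma extDeriv_ofSubsingleton_apply {f : EG → EG →L[ℝ] V} {x : EG} (hf : DifferentiableAt ℝ f x)
    (a b : EG) :
    extDeriv (fun y => ContinuousAlternatingMap.ofSubsingleton ℝ EG V (0 : Fin 1) (f y)) x ![a, b] =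
      fderiv ℝ f x a b - fderiv ℝ f x b a := by
  have h : DifferentiableAt ℝ (fun y => ContinuousAlternatingMap.ofSubsingleton ℝ EG V (0 : Fin 1)
      (f y)) x :=
    (ContinuousAlternatingMap.ofSubsingletonLIE (𝕜 := ℝ) (E := EG) (F := V)
      (0 : Fin 1)).differentiable.differentiableAt.comp _ hf
  have h2 : ∀ w z : EG, fderiv ℝ (fun y => f y w) x z = fderiv ℝ f x z w := fun w z => by
    rw [fderiv_clm_apply hf (differentiableAt_const w)]
    simp
  rw [extDeriv_apply h]
  simp [Fin.sum_univ_two, Fin.removeNth, h2, sub_eq_add_neg]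

/-- The coordinate expression of the one-form `θ` in the preferred chart around `u`, that is, the
pull back of `ω` along the inverse of this chart. -/
def formInChart (θ : ∀ u : G, TangentSpace 𝓘(ℝ, EG) u →L[ℝ] V) (u : G) (y : EG) : EG →L[ℝ] V :=
  (θ ((extChartAt 𝓘(ℝ, EG) u).symm y)).comp
    (mfderiv 𝓘(ℝ, EG) 𝓘(ℝ, EG) (extChartAt 𝓘(ℝ, EG) u).symm y)

/-- The value at `u` of the exterior derivative `dθ` of a one-form `θ`, computed in the preferred chart
around `u`. -/
def extDerivForm (θ : ∀ u : G, TangentSpace 𝓘(ℝ, EG) u →L[ℝ] V) (u : G)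
    (ξ η : TangentSpace 𝓘(ℝ, EG) u) : V :=
  extDeriv (fun y => ContinuousAlternatingMap.ofSubsingleton ℝ EG V (0 : Fin 1)
      (formInChart θ u y)) (extChartAt 𝓘(ℝ, EG) u u)
    ![mfderiv 𝓘(ℝ, EG) 𝓘(ℝ, EG) (extChartAt 𝓘(ℝ, EG) u) u ξ,
      mfderiv 𝓘(ℝ, EG) 𝓘(ℝ, EG) (extChartAt 𝓘(ℝ, EG) u) u η]

lemma extDerivForm_self (θ : ∀ u : G, TangentSpace 𝓘(ℝ, EG) u →L[ℝ] V) (u : G)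
    (ξ : TangentSpace 𝓘(ℝ, EG) u) : extDerivForm θ u ξ ξ = 0 :=
  ContinuousAlternatingMap.map_eq_zero_of_eq
    (extDeriv (fun y => ContinuousAlternatingMap.ofSubsingleton ℝ EG V (0 : Fin 1)
      (formInChart θ u y)) (extChartAt 𝓘(ℝ, EG) u u)) _ (i := 0) (j := 1) rfl (by decide)

lemma extDerivForm_add (θ : ∀ u : G, TangentSpace 𝓘(ℝ, EG) u →L[ℝ] V) (u : G)
    (ξ ξ' η : TangentSpace 𝓘(ℝ, EG) u) :
    extDerivForm θ u (ξ + ξ') η = extDerivForm θ u ξ η + extDerivForm θ u ξ' η := by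
  unfold extDerivForm
  rw [map_add]
  exact AlternatingMap.map_vecCons_add (extDeriv (fun y => ContinuousAlternatingMap.ofSubsingleton ℝ EG V (0 : Fin 1)
      (formInChart θ u y)) (extChartAt 𝓘(ℝ, EG) u u)).toAlternatingMap _ _ _

lemma extDerivForm_smul (θ : ∀ u : G, TangentSpace 𝓘(ℝ, EG) u →L[ℝ] V) (u : G) (c : ℝ)
    (ξ η : TangentSpace 𝓘(ℝ, EG) u) :
    extDerivForm θ u (c • ξ) η = c • extDerivForm θ u ξ η := by
  unfold extDerivForm
  rw [map_smul]
  exact AlternatingMap.map_vecCons_smul (extDeriv (fun y => ContinuousAlternatingMap.ofSubsingleton ℝ EG V (0 : Fin 1)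
      (formInChart θ u y)) (extChartAt 𝓘(ℝ, EG) u u)).toAlternatingMap _ _ _

lemma extDerivForm_skew (θ : ∀ u : G, TangentSpace 𝓘(ℝ, EG) u →L[ℝ] V) (u : G)
    (ξ η : TangentSpace 𝓘(ℝ, EG) u) : extDerivForm θ u ξ η = -extDerivForm θ u η ξ := by
  have h := AlternatingMap.map_swap (ContinuousAlternatingMap.toAlternatingMap
    (extDeriv (fun y => ContinuousAlternatingMap.ofSubsingleton ℝ EG V (0 : Fin 1)
      (formInChart θ u y)) (extChartAt 𝓘(ℝ, EG) u u)))
    ![mfderiv 𝓘(ℝ, EG) 𝓘(ℝ, EG) (extChartAt 𝓘(ℝ, EG) u) u η,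
      mfderiv 𝓘(ℝ, EG) 𝓘(ℝ, EG) (extChartAt 𝓘(ℝ, EG) u) u ξ] (i := 0) (j := 1) (by decide)
  unfold extDerivForm
  refine Eq.trans ?_ h
  refine congrArg (extDeriv (fun y => ContinuousAlternatingMap.ofSubsingleton ℝ EG V (0 : Fin 1)
      (formInChart θ u y)) (extChartAt 𝓘(ℝ, EG) u u)) ?_
  ext i
  fin_cases i <;> rfl

/-- The exterior derivative of a one-form in terms of the derivative of its coordinate
expression. -/
lemma extDerivForm_eq (θ : ∀ u : G, TangentSpace 𝓘(ℝ, EG) u →L[ℝ] V) (u : G)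
    (hθ : DifferentiableAt ℝ (formInChart θ u) (extChartAt 𝓘(ℝ, EG) u u))
    (ξ η : TangentSpace 𝓘(ℝ, EG) u) :
    extDerivForm θ u ξ η =
      fderiv ℝ (formInChart θ u) (extChartAt 𝓘(ℝ, EG) u u)
        (mfderiv 𝓘(ℝ, EG) 𝓘(ℝ, EG) (extChartAt 𝓘(ℝ, EG) u) u ξ)
        (mfderiv 𝓘(ℝ, EG) 𝓘(ℝ, EG) (extChartAt 𝓘(ℝ, EG) u) u η) -
      fderiv ℝ (formInChart θ u) (extChartAt 𝓘(ℝ, EG) u u)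
        (mfderiv 𝓘(ℝ, EG) 𝓘(ℝ, EG) (extChartAt 𝓘(ℝ, EG) u) u η)
        (mfderiv 𝓘(ℝ, EG) 𝓘(ℝ, EG) (extChartAt 𝓘(ℝ, EG) u) u ξ) :=
  extDeriv_ofSubsingleton_apply hθ _ _

end Forms

/-! ### Cartan connections, curvature and essential curvature -/

section Cartan

variable {𝔤 : Type*} [NormedAddCommGroup 𝔤] [NormedSpace ℝ 𝔤] [LieBracketOn 𝔤]
  {EP : Type*} [NormedAddCommGroup EP] [NormedSpace ℝ EP]
  {P : Type*} [TopologicalSpace P] [ChartedSpace EP P] [Group P]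
  {EG : Type*} [NormedAddCommGroup EG] [NormedSpace ℝ EG]
  {G : Type*} [TopologicalSpace G] [ChartedSpace EG G] [IsManifold 𝓘(ℝ, EG) ∞ G]
  {EM : Type*} [NormedAddCommGroup EM] [NormedSpace ℝ EM]
  {M : Type*} [TopologicalSpace M] [ChartedSpace EM M]

variable (A : AdmissiblePair 𝔤 P (EP := EP))
  (B : PrincipalBundle P G M (EP := EP) (EG := EG) (EM := EM))

/-- A Cartan connection of type `(𝔤, P)` on the principal bundle `B`. Together they form a Cartan
geometry. -/
structure CartanConnection where
  /-- the underlying `𝔤`-valued one-form `ω` -/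
  form : ∀ u : G, TangentSpace 𝓘(ℝ, EG) u →L[ℝ] 𝔤
  smooth : ContMDiff 𝓘(ℝ, EG) (𝓘(ℝ, EG).prod 𝓘(ℝ, EG →L[ℝ] 𝔤)) ∞
    (fun u => (⟨u, form u⟩ : Bundle.TotalSpace (EG →L[ℝ] 𝔤)
      (fun u : G => TangentSpace 𝓘(ℝ, EG) u →L[ℝ] Bundle.Trivial G 𝔤 u)))
  /-- `(r^g)^* ω = Ad(g⁻¹) ∘ ω` -/
  equivariant : ∀ (g : P) (u : G) (ξ : TangentSpace 𝓘(ℝ, EG) u),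
    form (B.act u g) (mfderiv 𝓘(ℝ, EG) 𝓘(ℝ, EG) (fun u => B.act u g) u ξ) = A.Ad g⁻¹ (form u ξ)
  /-- `ω(ζ_X) = X`, where the value of the fundamental vector field `ζ_X` at `u` is the derivative
  of `g ↦ u · g` at the neutral element in direction `X` -/
  fundamental : ∀ (u : G) (v : GroupLieAlgebra 𝓘(ℝ, EP) P),
    form (B.act u 1) (mfderiv 𝓘(ℝ, EP) 𝓘(ℝ, EG) (fun g : P => B.act u g) 1 v) = A.lieIso v
  bijective : ∀ u, Function.Bijective (form u)

namespace CartanConnection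

variable {A B} (C : CartanConnection A B)

/-- The linear isomorphism `ω_u : T_u G → 𝔤`. -/
def iso (u : G) : TangentSpace 𝓘(ℝ, EG) u ≃ₗ[ℝ] 𝔤 :=
  LinearEquiv.ofBijective (C.form u : TangentSpace 𝓘(ℝ, EG) u →ₗ[ℝ] 𝔤) (C.bijective u)

/-- The curvature `K(ξ, η) = dω(ξ, η) + [ω(ξ), ω(η)]`. -/
def curvature (u : G) (ξ η : TangentSpace 𝓘(ℝ, EG) u) : 𝔤 :=
  extDerivForm C.form u ξ η + ⁅C.form u ξ, C.form u η⁆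

lemma curvature_add (u : G) (ξ ξ' η : TangentSpace 𝓘(ℝ, EG) u) :
    C.curvature u (ξ + ξ') η = C.curvature u ξ η + C.curvature u ξ' η := by
  simp only [curvature, extDerivForm_add, map_add, add_lie]
  abel

lemma curvature_smul (u : G) (c : ℝ) (ξ η : TangentSpace 𝓘(ℝ, EG) u) :
    C.curvature u (c • ξ) η = c • C.curvature u ξ η := by
  simp only [curvature, extDerivForm_smul, map_smul, smul_lie, smul_add]

lemma curvature_skew (u : G) (ξ η : TangentSpace 𝓘(ℝ, EG) u) :
    C.curvature u ξ η = -C.curvature u η ξ := by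
  simp only [curvature]
  rw [extDerivForm_skew, ← lie_skew (C.form u ξ), neg_add]

lemma curvature_add_right (u : G) (ξ η η' : TangentSpace 𝓘(ℝ, EG) u) :
    C.curvature u ξ (η + η') = C.curvature u ξ η + C.curvature u ξ η' := by
  rw [C.curvature_skew, C.curvature_add, neg_add, ← C.curvature_skew, ← C.curvature_skew]

lemma curvature_smul_right (u : G) (c : ℝ) (ξ η : TangentSpace 𝓘(ℝ, EG) u) :
    C.curvature u ξ (c • η) = c • C.curvature u ξ η := by
  rw [C.curvature_skew, C.curvature_smul, ← smul_neg, ← C.curvature_skew]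

/-- Regularity: `ω(ξ) ∈ 𝔤^i` and `ω(η) ∈ 𝔤^j` imply `K(ξ, η) ∈ 𝔤^{i+j+1}`. -/
def IsRegular : Prop :=
  ∀ (u : G) (ξ η : TangentSpace 𝓘(ℝ, EG) u) (i j : ℤ), C.form u ξ ∈ A.F i → C.form u η ∈ A.F j →
    C.curvature u ξ η ∈ A.F (i + j + 1)

/-- The curvature function `κ(u)(X, Y) = K_u(ω_u⁻¹(X), ω_u⁻¹(Y))`. -/
def curvatureFunction (u : G) : 𝔤 [⋀^Fin 2]→ₗ[ℝ] 𝔤 where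
  toFun v := C.curvature u ((C.iso u).symm (v 0)) ((C.iso u).symm (v 1))
  map_update_add' v i X Y := by
    obtain rfl := Subsingleton.elim ‹DecidableEq (Fin 2)› (instDecidableEqFin 2)
    fin_cases i
    · simp [C.curvature_add]
    · simp [C.curvature_add_right]
  map_update_smul' v i c X := by
    obtain rfl := Subsingleton.elim ‹DecidableEq (Fin 2)› (instDecidableEqFin 2)
    fin_cases i
    · simp [C.curvature_smul]
    · simp [C.curvature_smul_right]
  map_eq_zero_of_eq' v i j h hij := by
    have h01 : v 0 = v 1 := by
      fin_cases i <;> fin_cases j <;> simp_all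
    simp [h01, curvature, extDerivForm_self]

lemma curvatureFunction_apply (u : G) (X Y : 𝔤) : C.curvatureFunction u ![X, Y] =
    C.curvature u ((C.iso u).symm X) ((C.iso u).symm Y) := rfl

/-- Normality of type `N`: the curvature function has values in `N`. -/
def IsNormal (N : Submodule ℝ (𝔤 [⋀^Fin 2]→ₗ[ℝ] 𝔤)) : Prop :=
  ∀ u, C.curvatureFunction u ∈ N

/-- The essential curvature function `κ_e : G → N / N'` induced by `κ`. -/
def essentialCurvature {N : Submodule ℝ (𝔤 [⋀^Fin 2]→ₗ[ℝ] 𝔤)} (hN : C.IsNormal N)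
    (N' : Submodule ℝ (𝔤 [⋀^Fin 2]→ₗ[ℝ] 𝔤)) (u : G) : N ⧸ N'.submoduleOf N :=
  Submodule.Quotient.mk ⟨C.curvatureFunction u, hN u⟩

end CartanConnection

end Cartan

end

open scoped Manifold ContDiff DirectSum
open LieModule.Cohomology

noncomputable section

/-! Vanishing of the essential curvature says that `κ` takes values in the negligible submodule, and
the proof pushes the homogeneity degree of `κ` up until no room is left. Regularity and
horizontality of normal curvature give degree at least `1`. Suppose all values of `κ` have degree at
least `ℓ > 0`. The Bianchi identity writes the cyclic sum of `[κ(X, Y), Z] + κ([X, Y], Z)` as the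
cyclic sum of the derivatives of `κ(Y, Z)` along `ω⁻¹(X)` plus that of `κ(κ(X, Y), Z)`. For `X`,
`Y`, `Z` of negative degrees `i`, `j`, `k` the right hand side has filtration degree above `i + j +
k + ℓ`: differentiating stays in `𝔤^{j+k+ℓ}` and `i < 0`, while `κ` applied twice gains `2ℓ > ℓ`.
The left hand side is, up to sign and higher filtration degree, the Chevalley–Eilenberg differential
of `gr_ℓ(κ(u))`, which is therefore a cocycle in `gr_ℓ` of the negligible submodule, hence zero. So
`κ` has degree at least `ℓ + 1`, and finiteness of the filtration ends the induction.

The analysis is in `exists_bianchi`, which transports `bianchi_of_curvature_eq` from a chart to the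
curvature function; the algebra is in `grMap_mem_twoCocycle`; they meet in
`grMap_curvatureFunction_mem_twoCocycle`. -/

/-! ### The Bianchi identity on a vector space -/

open Filter Topology in
/-- The Bianchi identity for the curvature `K = dθ + [θ, θ]` of a one-form `θ` with values in a Lie
algebra with bracket `β`, where `κ` expresses `K` in terms of `θ`. -/
lemma bianchi_of_curvature_eq {E V : Type*} [NormedAddCommGroup E] [NormedSpace ℝ E]
    [NormedAddCommGroup V] [NormedSpace ℝ V] (β : V →L[ℝ] V →L[ℝ] V)
    (hβ : ∀ x y, β x y = -β y x) (hJ : ∀ x y z, β (β x y) z + β (β y z) x + β (β z x) y = 0)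
    {θ : E → E →L[ℝ] V} {κ : E → V →L[ℝ] V →L[ℝ] V} {y : E}
    (hθ : ContDiffAt ℝ 2 θ y) (hκ : DifferentiableAt ℝ κ y)
    (hK : ∀ᶠ z in 𝓝 y, ∀ b c, fderiv ℝ θ z b c - fderiv ℝ θ z c b + β (θ z b) (θ z c) =
      κ z (θ z b) (θ z c))
    (hκs : ∀ x z, κ y x z = -κ y z x) (a b c : E) :
    fderiv ℝ κ y a (θ y b) (θ y c) + fderiv ℝ κ y b (θ y c) (θ y a) +
        fderiv ℝ κ y c (θ y a) (θ y b) =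
      β (κ y (θ y a) (θ y b)) (θ y c) + β (κ y (θ y b) (θ y c)) (θ y a) +
        β (κ y (θ y c) (θ y a)) (θ y b) -
      (κ y (κ y (θ y a) (θ y b)) (θ y c) + κ y (κ y (θ y b) (θ y c)) (θ y a) +
        κ y (κ y (θ y c) (θ y a)) (θ y b)) +
      (κ y (β (θ y a) (θ y b)) (θ y c) + κ y (β (θ y b) (θ y c)) (θ y a) +
        κ y (β (θ y c) (θ y a)) (θ y b)) := by
  have hθ1 : HasFDerivAt θ (fderiv ℝ θ y) y := (hθ.differentiableAt (by norm_num)).hasFDerivAt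
  have hθ2 : HasFDerivAt (fderiv ℝ θ) (fderiv ℝ (fderiv ℝ θ) y) y :=
    ((hθ.fderiv_right (m := 1) (by norm_num)).differentiableAt (by norm_num)).hasFDerivAt
  have hκ1 := hκ.hasFDerivAt
  have hsymm : ∀ a b, fderiv ℝ (fderiv ℝ θ) y a b = fderiv ℝ (fderiv ℝ θ) y b a :=
    fun a b => (hθ.isSymmSndFDerivAt (by simp)) a b
  -- The structure equation `hK`, evaluated on the constant vectors `b` and `c`, is differentiated
  -- at `y` in direction `a`.
  have key : ∀ a b c : E,
      fderiv ℝ (fderiv ℝ θ) y a b c - fderiv ℝ (fderiv ℝ θ) y a c b +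
        (β (fderiv ℝ θ y a b) (θ y c) + β (θ y b) (fderiv ℝ θ y a c)) =
      fderiv ℝ κ y a (θ y b) (θ y c) + κ y (fderiv ℝ θ y a b) (θ y c) +
        κ y (θ y b) (fderiv ℝ θ y a c) := by
    intro a b c
    have e : ∀ v : E, HasFDerivAt (fun _ : E => v) (0 : E →L[ℝ] E) y :=
      fun v => hasFDerivAt_const v y
    have l1 := ((hθ2.clm_apply (e b)).clm_apply (e c)).sub ((hθ2.clm_apply (e c)).clm_apply (e b))
    have tb := hθ1.clm_apply (e b)
    have tc := hθ1.clm_apply (e c)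
    have l2 := (β.hasFDerivAt.comp y tb).clm_apply tc
    have r := (hκ1.clm_apply tb).clm_apply tc
    have hEq := ((l1.add l2).congr_of_eventuallyEq (f₁ := fun z => κ z (θ z b) (θ z c))
      (hK.mono fun z hz => (hz b c).symm)).unique r
    have := congrArg (fun f : E →L[ℝ] V => f a) hEq
    simp at this
    rw [add_comm (β (fderiv ℝ θ y a b) (θ y c)), this]
    abel
  -- At `y` itself the structure equation eliminates the antisymmetrized first derivatives of `θ`.
  have hd : ∀ a b, fderiv ℝ θ y a b - fderiv ℝ θ y b a =
      κ y (θ y a) (θ y b) - β (θ y a) (θ y b) := fun a b => by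
    rw [← hK.self_of_nhds a b]; abel
  have hκd : ∀ a b c, κ y (fderiv ℝ θ y a b) (θ y c) - κ y (fderiv ℝ θ y b a) (θ y c) =
      κ y (κ y (θ y a) (θ y b)) (θ y c) - κ y (β (θ y a) (θ y b)) (θ y c) := fun a b c => by
    simpa using congrArg (fun v => κ y v (θ y c)) (hd a b)
  have hβd : ∀ a b c, β (fderiv ℝ θ y a b) (θ y c) - β (fderiv ℝ θ y b a) (θ y c) =
      β (κ y (θ y a) (θ y b)) (θ y c) - β (β (θ y a) (θ y b)) (θ y c) := fun a b c => by
    simpa using congrArg (fun v => β v (θ y c)) (hd a b)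
  have k1 := key a b c
  have k2 := key b c a
  have k3 := key c a b
  -- With every derivative of `θ` in the first slot, the cyclic sum contains these derivatives only
  -- in the antisymmetrized form of `hd`; the second derivatives cancel by symmetry and the double
  -- brackets by Jacobi.
  rw [hβ (θ y _) (fderiv ℝ θ y _ _), hκs (θ y _) (fderiv ℝ θ y _ _)] at k1 k2 k3
  have s1 := congrArg (fun f : E →L[ℝ] V => f c) (hsymm a b)
  have s2 := congrArg (fun f : E →L[ℝ] V => f a) (hsymm b c)
  have s3 := congrArg (fun f : E →L[ℝ] V => f b) (hsymm c a)
  have J := hJ (θ y a) (θ y b) (θ y c)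
  have p1 := hκd a b c
  have p2 := hκd b c a
  have p3 := hκd c a b
  have q1 := hβd a b c
  have q2 := hβd b c a
  have q3 := hβd c a b
  linear_combination (norm := module) -k1 - k2 - k3 + q1 + q2 + q3 - p1 - p2 - p3 + s1 + s2 + s3 - J

/-! ### One-forms in charts and chart independence of the exterior derivative -/

section ChartForms

open Filter Topology

variable {EG : Type*} [NormedAddCommGroup EG] [NormedSpace ℝ EG]
  {G : Type*} [TopologicalSpace G] [ChartedSpace EG G] [IsManifold 𝓘(ℝ, EG) ∞ G]
  {V : Type*} [NormedAddCommGroup V] [NormedSpace ℝ V]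
  (θ : ∀ u : G, TangentSpace 𝓘(ℝ, EG) u →L[ℝ] V)

/-- The derivative of the inverse of the preferred chart around `u`, as a linear map between model
spaces. -/
def chartSymmDeriv (u : G) (y : EG) : EG →L[ℝ] EG :=
  mfderiv 𝓘(ℝ, EG) 𝓘(ℝ, EG) (extChartAt 𝓘(ℝ, EG) u).symm y

/-- The derivative of the preferred chart around `u`, as a linear map between model spaces. -/
def chartDeriv (u v : G) : EG →L[ℝ] EG :=
  mfderiv 𝓘(ℝ, EG) 𝓘(ℝ, EG) (extChartAt 𝓘(ℝ, EG) u) v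

lemma isManifold_one : IsManifold 𝓘(ℝ, EG) 1 G := .of_le (n := ∞) (by norm_num)

lemma chartSymmDeriv_comp_chartDeriv {u v : G} (h : v ∈ (extChartAt 𝓘(ℝ, EG) u).source) :
    (chartSymmDeriv u (extChartAt 𝓘(ℝ, EG) u v)).comp (chartDeriv u v) =
      ContinuousLinearMap.id ℝ EG := by
  have := isManifold_one (EG := EG) (G := G)
  have := mfderivWithin_extChartAt_symm_comp_mfderiv_extChartAt' h
  simp only [modelWithCornersSelf_coe, Set.range_id, mfderivWithin_univ] at this
  exact this

lemma chartDeriv_comp_chartSymmDeriv {u v : G} (h : v ∈ (extChartAt 𝓘(ℝ, EG) u).source) :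
    (chartDeriv u v).comp (chartSymmDeriv u (extChartAt 𝓘(ℝ, EG) u v)) =
      ContinuousLinearMap.id ℝ EG := by
  have := isManifold_one (EG := EG) (G := G)
  have := mfderiv_extChartAt_comp_mfderivWithin_extChartAt_symm' h
  simp only [modelWithCornersSelf_coe, Set.range_id, mfderivWithin_univ] at this
  exact this

omit [IsManifold 𝓘(ℝ, EG) ∞ G] in
lemma formInChart_extChartAt {u v : G} (h : v ∈ (extChartAt 𝓘(ℝ, EG) u).source) :
    formInChart θ u (extChartAt 𝓘(ℝ, EG) u v) =
      (show EG →L[ℝ] V from θ v).comp (chartSymmDeriv u (extChartAt 𝓘(ℝ, EG) u v)) :=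
  -- The base points agree only propositionally; reading all tangent spaces as `EG` avoids a
  -- transport along this equality.
  congrArg (fun w : G => (show EG →L[ℝ] V from θ w).comp
    (chartSymmDeriv u (extChartAt 𝓘(ℝ, EG) u v))) ((extChartAt 𝓘(ℝ, EG) u).left_inv h)

lemma formInChart_extChartAt_comp {u v : G} (h : v ∈ (extChartAt 𝓘(ℝ, EG) u).source) :
    (formInChart θ u (extChartAt 𝓘(ℝ, EG) u v)).comp (chartDeriv u v) = θ v := by
  rw [formInChart_extChartAt θ h, ContinuousLinearMap.comp_assoc,
    chartSymmDeriv_comp_chartDeriv h]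
  rfl

variable {θ} in
/-- The coordinate expression of a smooth one-form is smooth. -/
lemma contDiffAt_formInChart (u : G)
    (h : ContMDiffAt 𝓘(ℝ, EG) (𝓘(ℝ, EG).prod 𝓘(ℝ, EG →L[ℝ] V)) ∞
      (fun u => (⟨u, θ u⟩ : Bundle.TotalSpace (EG →L[ℝ] V)
        (fun u : G => TangentSpace 𝓘(ℝ, EG) u →L[ℝ] Bundle.Trivial G V u))) u) :
    ContDiffAt ℝ ∞ (formInChart θ u) (extChartAt 𝓘(ℝ, EG) u u) := by
  have := isManifold_one (EG := EG) (G := G)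
  rw [contMDiffAt_hom_bundle] at h
  have h2 := h.2
  rw [contMDiffAt_iff] at h2
  have h3 := h2.2
  simp only [modelWithCornersSelf_coe, Set.range_id, contDiffWithinAt_univ] at h3
  refine h3.congr_of_eventuallyEq ?_
  -- The trivialization of the hom bundle at `u` reads `θ w` as its composite with the derivative of
  -- the inverse chart, which is the coordinate expression of `θ`.
  have key : ∀ w ∈ (chartAt EG u).source,
      ContinuousLinearMap.inCoordinates EG (TangentSpace 𝓘(ℝ, EG)) V (Bundle.Trivial G V) u w u w
        (θ w) = (show EG →L[ℝ] V from θ w).comp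
          (chartSymmDeriv u (extChartAt 𝓘(ℝ, EG) u w)) := by
    intro w hw
    have hs := TangentBundle.symmL_trivializationAt (I := 𝓘(ℝ, EG)) hw
    simp only [modelWithCornersSelf_coe, Set.range_id, mfderivWithin_univ] at hs
    have ht : Bundle.Trivialization.continuousLinearMapAt ℝ
        (trivializationAt V (Bundle.Trivial G V) u) w = ContinuousLinearMap.id ℝ V :=
      Bundle.Trivial.continuousLinearMapAt_trivialization ℝ G V w
    rw [ContinuousLinearMap.inCoordinates, hs]
    exact congrArg (fun f : V →L[ℝ] V => f.comp ((show EG →L[ℝ] V from θ w).comp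
      (chartSymmDeriv u (extChartAt 𝓘(ℝ, EG) u w)))) ht
  filter_upwards [extChartAt_target_mem_nhds (I := 𝓘(ℝ, EG)) u] with y hy
  have hs := (extChartAt 𝓘(ℝ, EG) u).map_target hy
  rw [extChartAt_source] at hs
  refine Eq.trans ?_ (key _ hs).symm
  rw [(extChartAt 𝓘(ℝ, EG) u).right_inv hy]
  rfl

/-- The change of charts. -/
def chartTransition (u v : G) : EG → EG :=
  extChartAt 𝓘(ℝ, EG) v ∘ (extChartAt 𝓘(ℝ, EG) u).symm

lemma contDiffAt_chartTransition {u v w : G} (hu : w ∈ (extChartAt 𝓘(ℝ, EG) u).source)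
    (hv : w ∈ (extChartAt 𝓘(ℝ, EG) v).source) :
    ContDiffAt ℝ ∞ (chartTransition u v) (extChartAt 𝓘(ℝ, EG) u w) := by
  rw [← contMDiffAt_iff_contDiffAt]
  refine ContMDiffAt.comp _ (I' := 𝓘(ℝ, EG)) ?_ ?_
  · rw [(extChartAt 𝓘(ℝ, EG) u).left_inv hu]
    exact contMDiffAt_extChartAt' (by rwa [extChartAt_source] at hv)
  · exact (contMDiffOn_extChartAt_symm u).contMDiffAt
      ((isOpen_extChartAt_target u).mem_nhds ((extChartAt 𝓘(ℝ, EG) u).map_source hu))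

lemma fderiv_chartTransition {u v w : G} (hu : w ∈ (extChartAt 𝓘(ℝ, EG) u).source)
    (hv : w ∈ (extChartAt 𝓘(ℝ, EG) v).source) :
    fderiv ℝ (chartTransition u v) (extChartAt 𝓘(ℝ, EG) u w) =
      (chartDeriv v w).comp (chartSymmDeriv u (extChartAt 𝓘(ℝ, EG) u w)) := by
  rw [← mfderiv_eq_fderiv]
  have h1 : MDifferentiableAt 𝓘(ℝ, EG) 𝓘(ℝ, EG) (extChartAt 𝓘(ℝ, EG) v) w :=
    (contMDiffAt_extChartAt' (n := ∞) (by rwa [extChartAt_source] at hv)).mdifferentiableAt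
      (by norm_num)
  have h2 : MDifferentiableAt 𝓘(ℝ, EG) 𝓘(ℝ, EG) (extChartAt 𝓘(ℝ, EG) u).symm
      (extChartAt 𝓘(ℝ, EG) u w) :=
    ((contMDiffOn_extChartAt_symm (n := ∞) u).contMDiffAt
      ((isOpen_extChartAt_target u).mem_nhds
        ((extChartAt 𝓘(ℝ, EG) u).map_source hu))).mdifferentiableAt (by norm_num)
  have e := (extChartAt 𝓘(ℝ, EG) u).left_inv hu
  have h := mfderiv_comp_of_eq (x := extChartAt 𝓘(ℝ, EG) u w) h1 h2 e
  refine h.trans ?_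
  exact congrArg (fun z : G => (chartDeriv v z).comp
    (chartSymmDeriv u (extChartAt 𝓘(ℝ, EG) u w))) e

/-- The exterior derivative of a one-form at `v` can be computed in the preferred chart around
another point `u`. -/
lemma extDerivForm_eq_of_mem_source {u v : G} (hv : v ∈ (extChartAt 𝓘(ℝ, EG) u).source)
    (hd : DifferentiableAt ℝ (formInChart θ u) (extChartAt 𝓘(ℝ, EG) u v))
    (ξ η : TangentSpace 𝓘(ℝ, EG) v) :
    extDerivForm θ v ξ η =
      fderiv ℝ (formInChart θ u) (extChartAt 𝓘(ℝ, EG) u v) (chartDeriv u v ξ) (chartDeriv u v η) -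
      fderiv ℝ (formInChart θ u) (extChartAt 𝓘(ℝ, EG) u v) (chartDeriv u v η)
        (chartDeriv u v ξ) := by
  have hvv := mem_extChartAt_source (I := 𝓘(ℝ, EG)) v
  have hτ : chartTransition v u (extChartAt 𝓘(ℝ, EG) v v) = extChartAt 𝓘(ℝ, EG) u v := by
    simp [chartTransition]
  let Ω : EG → EG [⋀^Fin 1]→L[ℝ] V := fun y =>
    ContinuousAlternatingMap.ofSubsingleton ℝ EG V (0 : Fin 1) (formInChart θ u y)
  have hΩ : DifferentiableAt ℝ Ω (chartTransition v u (extChartAt 𝓘(ℝ, EG) v v)) := by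
    rw [hτ]
    exact (ContinuousAlternatingMap.ofSubsingletonLIE (𝕜 := ℝ) (E := EG) (F := V)
      (0 : Fin 1)).differentiable.differentiableAt.comp _ hd
  -- Near `v`, the expression of `θ` in the chart at `v` is the pullback of its expression in the
  -- chart at `u` along the transition map. The claim then follows since the exterior derivative
  -- commutes with pullbacks.
  have hev : (fun y => ContinuousAlternatingMap.ofSubsingleton ℝ EG V (0 : Fin 1)
      (formInChart θ v y)) =ᶠ[𝓝 (extChartAt 𝓘(ℝ, EG) v v)] fun y =>
      (Ω (chartTransition v u y)).compContinuousLinearMap (fderiv ℝ (chartTransition v u) y) := by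
    have hc : Tendsto (extChartAt 𝓘(ℝ, EG) v).symm (𝓝 (extChartAt 𝓘(ℝ, EG) v v)) (𝓝 v) := by
      have := (continuousAt_extChartAt_symm (I := 𝓘(ℝ, EG)) v).tendsto
      rwa [extChartAt_to_inv] at this
    filter_upwards [extChartAt_target_mem_nhds (I := 𝓘(ℝ, EG)) v,
      hc ((isOpen_extChartAt_source (I := 𝓘(ℝ, EG)) u).mem_nhds hv)] with y hy hyu
    obtain ⟨w, hw, rfl⟩ : ∃ w ∈ (extChartAt 𝓘(ℝ, EG) v).source, extChartAt 𝓘(ℝ, EG) v w = y :=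
      ⟨_, (extChartAt 𝓘(ℝ, EG) v).map_target hy, (extChartAt 𝓘(ℝ, EG) v).right_inv hy⟩
    rw [Set.mem_preimage, (extChartAt 𝓘(ℝ, EG) v).left_inv hw] at hyu
    ext a
    have h1 : formInChart θ v (extChartAt 𝓘(ℝ, EG) v w) =
        (formInChart θ u (chartTransition v u (extChartAt 𝓘(ℝ, EG) v w))).comp
          (fderiv ℝ (chartTransition v u) (extChartAt 𝓘(ℝ, EG) v w)) := by
      rw [fderiv_chartTransition hw hyu, ← ContinuousLinearMap.comp_assoc,
        formInChart_extChartAt θ hw]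
      congr 1
      rw [chartTransition, Function.comp_apply, (extChartAt 𝓘(ℝ, EG) v).left_inv hw]
      exact (formInChart_extChartAt_comp θ hyu).symm
    exact congrArg (fun f : EG →L[ℝ] V => f (a 0)) h1
  have hpull := extDeriv_pullback hΩ (contDiffAt_chartTransition (G := G) hvv hv)
    (by simp only [minSmoothness_of_isRCLikeNormedField]; exact WithTop.coe_le_coe.mpr (le_top : (2 : ℕ∞) ≤ ⊤))
  have hd1 : ∀ ζ : EG, fderiv ℝ (chartTransition v u) (extChartAt 𝓘(ℝ, EG) v v)
      (chartDeriv v v ζ) = chartDeriv u v ζ := fun ζ => by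
    rw [fderiv_chartTransition hvv hv]
    exact congrArg (chartDeriv u v) (congrArg (fun f : EG →L[ℝ] EG => f ζ)
      (chartSymmDeriv_comp_chartDeriv hvv))
  have h2 : extDerivForm θ v ξ η = extDeriv Ω (extChartAt 𝓘(ℝ, EG) u v)
      ![chartDeriv u v ξ, chartDeriv u v η] := by
    unfold extDerivForm
    rw [hev.extDeriv_eq, hpull, hτ]
    refine congrArg (extDeriv Ω (extChartAt 𝓘(ℝ, EG) u v)) ?_
    ext i
    fin_cases i
    · exact hd1 ξ
    · exact hd1 η
  rw [h2]
  exact extDeriv_ofSubsingleton_apply hd _ _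

end ChartForms

/-! ### Homogeneous cochains and the cocycle criterion -/

namespace LieFiltration

variable {𝔤 : Type*} [NormedAddCommGroup 𝔤] [NormedSpace ℝ 𝔤] [LieBracketOn 𝔤]
  (𝓕 : LieFiltration 𝔤)

/-- The element `X + 𝔤^{i+1}` of `𝔪` for `X ∈ 𝔤^i` with `i < 0`. -/
def negSym (i : ℤ) (hi : i < 0) : 𝓕.F i →ₗ[ℝ] 𝓕.negPart :=
  LinearMap.codRestrict 𝓕.negPart.toSubmodule (𝓕.sym i)
    fun X _ hk => 𝓕.proj_sym_of_ne (by omega) X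

lemma lie_negSym {i j : ℤ} (hi : i < 0) (hj : j < 0) (X : 𝓕.F i) (Y : 𝓕.F j) :
    ⁅𝓕.negSym i hi X, 𝓕.negSym j hj Y⁆ =
      𝓕.negSym (i + j) (by omega) ⟨⁅(X : 𝔤), (Y : 𝔤)⁆, 𝓕.lie_mem X.2 Y.2⟩ :=
  Subtype.ext (𝓕.lie_sym X Y)

lemma lie_negSym_sym {i j : ℤ} (hi : i < 0) (X : 𝓕.F i) (Y : 𝓕.F j) :
    ⁅𝓕.negSym i hi X, 𝓕.sym j Y⁆ =
      𝓕.sym (i + j) ⟨⁅(X : 𝔤), (Y : 𝔤)⁆, 𝓕.lie_mem X.2 Y.2⟩ :=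
  𝓕.lie_sym X Y

/-- The classes `X + 𝔤^{i+1}` with `i < 0` span `𝔪`, so identities of cochains need checking on
homogeneous elements only. -/
lemma negPart_linearMap_ext {M : Type*} [AddCommGroup M] [Module ℝ M] {f g : 𝓕.negPart →ₗ[ℝ] M}
    (h : ∀ i hi (X : 𝓕.F i), f (𝓕.negSym i hi X) = g (𝓕.negSym i hi X)) : f = g := by
  ext x
  obtain ⟨s, hs, hx⟩ := 𝓕.gr_eq_sum x
  have hneg : ∀ i ∈ s, i < 0 := fun i hi => by
    by_contra h'
    exact hs i hi (x.2 i (not_lt.mp h'))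
  choose X hX using fun i => 𝓕.incl_eq_sym i (𝓕.proj i x)
  have hx' : x = ∑ i ∈ s.attach, 𝓕.negSym i (hneg i i.2) (X i) := by
    apply Subtype.ext
    rw [hx, ← Finset.sum_attach]
    push_cast
    exact Finset.sum_congr rfl fun i _ => hX i
  rw [hx', map_sum, map_sum]
  exact Finset.sum_congr rfl fun i _ => h _ _ _

lemma sym_eq_zero_iff {i : ℤ} (X : 𝓕.F i) : 𝓕.sym i X = 0 ↔ (X : 𝔤) ∈ 𝓕.F (i + 1) := by
  refine ⟨fun h => ?_, 𝓕.sym_eq_zero X⟩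
  have h' : Submodule.mkQ ((𝓕.F (i + 1)).submoduleOf (𝓕.F i)) X = 0 :=
    DirectSum.of_injective (β := 𝓕.Piece) i (h.trans (map_zero (𝓕.incl i)).symm)
  rwa [Submodule.mkQ_apply, Submodule.Quotient.mk_eq_zero] at h'

lemma grMap_negSym {ℓ : ℤ} (α : 𝓕.horCochainGE ℓ) {i j : ℤ} (hi : i < 0) (hj : j < 0)
    (X : 𝓕.F i) (Y : 𝓕.F j) :
    𝓕.grMap ℓ α (𝓕.negSym i hi X) (𝓕.negSym j hj Y) =
      𝓕.sym (i + j + ℓ) ⟨altToBilin α.1 X Y, horCochainGE_mem α.2 i j X Y X.2 Y.2⟩ :=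
  𝓕.grBilin_sym _ _ _ X Y

variable {𝓕}

/-- An element of `L(Λ²(𝔤/𝔭), 𝔤)^ℓ` in the kernel of `gr_ℓ` lies in `L(Λ²(𝔤/𝔭), 𝔤)^{ℓ+1}`. -/
lemma mem_horCochainGE_succ_of_grMap_eq_zero {ℓ : ℤ} {α : 𝓕.horCochainGE ℓ}
    (h : 𝓕.grMap ℓ α = 0) : α.1 ∈ 𝓕.horCochainGE (ℓ + 1) := by
  refine ⟨α.2.1, fun i hi j hj X hX Y hY => ?_⟩
  have h1 := 𝓕.grMap_negSym α hi hj ⟨X, hX⟩ ⟨Y, hY⟩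
  rw [h] at h1
  rw [← add_assoc]
  exact (𝓕.sym_eq_zero_iff _).mp h1.symm

/-- `gr_ℓ(α)` is a cocycle if the cyclic sum of `[α(X, Y), Z] - α([X, Y], Z)` vanishes up to terms of
higher filtration degree. -/
lemma grMap_mem_twoCocycle {ℓ : ℤ} (α : 𝓕.horCochainGE ℓ)
    (h : ∀ i < 0, ∀ j < 0, ∀ k < 0, ∀ X ∈ 𝓕.F i, ∀ Y ∈ 𝓕.F j, ∀ Z ∈ 𝓕.F k,
      ⁅altToBilin α.1 X Y, Z⁆ + ⁅altToBilin α.1 Y Z, X⁆ + ⁅altToBilin α.1 Z X, Y⁆ +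
        (altToBilin α.1 ⁅X, Y⁆ Z + altToBilin α.1 ⁅Y, Z⁆ X + altToBilin α.1 ⁅Z, X⁆ Y) ∈
          𝓕.F (i + j + k + ℓ + 1)) :
    𝓕.grMap ℓ α ∈ twoCocycle ℝ 𝓕.negPart 𝓕.Gr := by
  rw [mem_twoCocycle_iff]
  refine 𝓕.negPart_linearMap_ext fun i hi X => 𝓕.negPart_linearMap_ext fun j hj Y =>
    𝓕.negPart_linearMap_ext fun k hk Z => ?_
  have skew : ∀ X Y, altToBilin α.1 X Y = -altToBilin α.1 Y X := fun X Y => alt_skew α.1 X Y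
  have hmem := fun i j X Y => horCochainGE_mem α.2 i j X Y
  have cast : ∀ {a b : ℤ} (x : 𝓕.F a) (e : b = a), 𝓕.sym a x = 𝓕.sym b ⟨x, e ▸ x.2⟩ :=
    fun x e => 𝓕.sym_congr e.symm rfl
  simp only [d₂₃_apply, lie_negSym, grMap_negSym, lie_negSym_sym, LinearMap.zero_apply]
  -- The six terms of the differential carry differently bracketed degrees; all are moved to `i + j
  -- + k + ℓ` so that they add up under a single `sym`.
  rw [cast (b := i + j + k + ℓ) _ (by ring), cast (a := j + _) (b := i + j + k + ℓ) _ (by ring),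
    cast (a := k + _) (b := i + j + k + ℓ) _ (by ring),
    cast (a := i + j + k + ℓ) (b := i + j + k + ℓ) _ (by ring),
    cast (a := i + k + j + ℓ) (b := i + j + k + ℓ) _ (by ring),
    cast (a := j + k + i + ℓ) (b := i + j + k + ℓ) _ (by ring)]
  simp only [← map_add, ← map_sub]
  apply 𝓕.sym_eq_zero
  -- By skew symmetry, the representative of the differential is minus the cyclic sum in `h`.
  have h' := neg_mem (h i hi j hj k hk X X.2 Y Y.2 Z Z.2)
  convert h' using 1
  simp only [Submodule.coe_add, Submodule.coe_sub]
  rw [← lie_skew (X : 𝔤), ← lie_skew (Y : 𝔤) (altToBilin _ _ _), ← lie_skew (Z : 𝔤) (altToBilin _ _ _),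
    skew (X : 𝔤) (Z : 𝔤), ← lie_skew (Z : 𝔤) (X : 𝔤)]
  simp only [neg_lie, map_neg, LinearMap.neg_apply]
  abel

/-- `L(Λ²(𝔤/𝔭), 𝔤)^ℓ` vanishes for large `ℓ`. -/
lemma horCochainGE_eq_zero {ℓ : ℤ} (hℓ : 2 * 𝓕.μ + 𝓕.ν + 3 ≤ ℓ) {α : 𝔤 [⋀^Fin 2]→ₗ[ℝ] 𝔤}
    (hα : α ∈ 𝓕.horCochainGE ℓ) (X Y : 𝔤) : α ![X, Y] = 0 := by
  -- The index `-μ - 1` is negative even for `μ = 0`, as the homogeneity condition requires. Two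
  -- such arguments give values in `𝔤^{ℓ-2μ-2}`, which lies in `𝔤^{ν+1} = 0` exactly under the
  -- stated bound.
  have htop : ∀ X, X ∈ 𝓕.F (-(𝓕.μ : ℤ) - 1) := fun X =>
    𝓕.anti (by omega : -(𝓕.μ : ℤ) - 1 ≤ -𝓕.μ) (𝓕.F_neg_depth ▸ Submodule.mem_top)
  have := 𝓕.anti (by omega : (𝓕.ν : ℤ) + 1 ≤ _)
    (hα.2 _ (by omega) _ (by omega) X (htop X) Y (htop Y))
  rwa [𝓕.F_height_succ, Submodule.mem_bot] at this

end LieFiltration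

/-! ### Two facts on derivatives in finite dimensions -/

section Bianchi

open Filter Topology

/-- A linear projection with kernel `W` is continuous in finite dimensions and annihilates `f` near
`y`, hence also its derivative. This is why differentiating `κ` does not lower its filtration
degree. -/
lemma fderiv_apply_mem_of_eventually_mem {E V : Type*} [NormedAddCommGroup E] [NormedSpace ℝ E]
    [NormedAddCommGroup V] [NormedSpace ℝ V] [FiniteDimensional ℝ V] {f : E → V} {y : E}
    (hf : DifferentiableAt ℝ f y) (W : Submodule ℝ V) (h : ∀ᶠ z in 𝓝 y, f z ∈ W) (a : E) :
    fderiv ℝ f y a ∈ W := by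
  obtain ⟨W', hW'⟩ := W.exists_isCompl
  let π : V →L[ℝ] W' := LinearMap.toContinuousLinearMap (W'.projectionOnto W hW'.symm)
  have hπ : ∀ v, π v = 0 ↔ v ∈ W := fun v => Submodule.projectionOnto_apply_eq_zero_iff hW'.symm
  have h1 := (π.hasFDerivAt.comp y hf.hasFDerivAt).congr_of_eventuallyEq
    (f₁ := fun _ => (0 : W')) (h.mono fun z hz => ((hπ _).mpr hz).symm)
  have h2 := h1.unique (hasFDerivAt_const (0 : W') y)
  exact (hπ _).mp (congrArg (fun g : E →L[ℝ] W' => g a) h2)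

/-- In a basis of `V`, `f` is a finite sum of fixed coordinate functionals times its values on the
basis vectors. -/
lemma differentiableAt_of_apply {E V W : Type*} [NormedAddCommGroup E] [NormedSpace ℝ E]
    [NormedAddCommGroup V] [NormedSpace ℝ V] [FiniteDimensional ℝ V]
    [NormedAddCommGroup W] [NormedSpace ℝ W] {f : E → V →L[ℝ] W} {y : E}
    (h : ∀ X, DifferentiableAt ℝ (fun z => f z X) y) : DifferentiableAt ℝ f y := by
  let b := Module.finBasis ℝ V
  let e : V ≃L[ℝ] (Fin (Module.finrank ℝ V) → ℝ) := b.equivFunL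
  have hf : f = fun z => ∑ i, ((ContinuousLinearMap.proj (R := ℝ) i).comp
      (e : V →L[ℝ] (Fin (Module.finrank ℝ V) → ℝ))).smulRight (f z (b i)) := by
    funext z
    ext v
    simp only [e, sum_apply, ContinuousLinearMap.smulRight_apply,
      ContinuousLinearMap.comp_apply, ContinuousLinearMap.proj_apply,
      ContinuousLinearEquiv.coe_coe, Module.Basis.equivFunL_apply]
    conv_lhs => rw [← b.sum_repr v, map_sum]
    simp only [map_smul]
  rw [hf]
  refine DifferentiableAt.fun_sum fun i _ => ?_
  exact ((ContinuousLinearMap.smulRightL ℝ V W _).differentiableAt).comp y (h (b i))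

end Bianchi

/-! ### The Bianchi identity for the curvature function -/

namespace CartanConnection

open Filter Topology

variable {𝔤 : Type*} [NormedAddCommGroup 𝔤] [NormedSpace ℝ 𝔤] [FiniteDimensional ℝ 𝔤]
  [LieBracketOn 𝔤]
  {EP : Type*} [NormedAddCommGroup EP] [NormedSpace ℝ EP]
  {P : Type*} [TopologicalSpace P] [ChartedSpace EP P] [Group P]
  {EG : Type*} [NormedAddCommGroup EG] [NormedSpace ℝ EG]
  {G : Type*} [TopologicalSpace G] [ChartedSpace EG G] [IsManifold 𝓘(ℝ, EG) ∞ G]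
  {EM : Type*} [NormedAddCommGroup EM] [NormedSpace ℝ EM]
  {M : Type*} [TopologicalSpace M] [ChartedSpace EM M]
  {A : AdmissiblePair 𝔤 P (EP := EP)}
  {B : PrincipalBundle P G M (EP := EP) (EG := EG) (EM := EM)}
  (C : CartanConnection A B)

omit [FiniteDimensional ℝ 𝔤] in
/-- The curvature function in terms of the coordinate expression of the Cartan connection. -/
lemma curvatureFunction_formInChart {u v : G} (hv : v ∈ (extChartAt 𝓘(ℝ, EG) u).source)
    (hd : DifferentiableAt ℝ (formInChart C.form u) (extChartAt 𝓘(ℝ, EG) u v)) (b c : EG) :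
    C.curvatureFunction v ![formInChart C.form u (extChartAt 𝓘(ℝ, EG) u v) b,
        formInChart C.form u (extChartAt 𝓘(ℝ, EG) u v) c] =
      fderiv ℝ (formInChart C.form u) (extChartAt 𝓘(ℝ, EG) u v) b c -
        fderiv ℝ (formInChart C.form u) (extChartAt 𝓘(ℝ, EG) u v) c b +
      ⁅formInChart C.form u (extChartAt 𝓘(ℝ, EG) u v) b,
        formInChart C.form u (extChartAt 𝓘(ℝ, EG) u v) c⁆ := by
  have hform : ∀ b : EG, C.iso v (chartSymmDeriv u (extChartAt 𝓘(ℝ, EG) u v) b) =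
      formInChart C.form u (extChartAt 𝓘(ℝ, EG) u v) b := fun b => by
    rw [formInChart_extChartAt C.form hv]
    rfl
  -- The tangent vector at `v` with coordinates `b` is the preimage under `ω_v` of the value of the
  -- local form on `b`.
  have hsymm : ∀ b : EG, (C.iso v).symm (formInChart C.form u (extChartAt 𝓘(ℝ, EG) u v) b) =
      chartSymmDeriv u (extChartAt 𝓘(ℝ, EG) u v) b := fun b =>
    (LinearEquiv.symm_apply_eq _).mpr (hform b).symm
  have hinv : ∀ b : EG, chartDeriv u v (chartSymmDeriv u (extChartAt 𝓘(ℝ, EG) u v) b) = b :=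
    fun b => congrArg (fun f : EG →L[ℝ] EG => f b) (chartDeriv_comp_chartSymmDeriv hv)
  refine (congrArg₂ (C.curvature v) (hsymm b) (hsymm c)).trans ?_
  refine (congrArg₂ (· + ·) (extDerivForm_eq_of_mem_source C.form hv hd _ _)
    (congrArg₂ Bracket.bracket (hform b) (hform c))).trans ?_
  simp only [hinv]

omit [FiniteDimensional ℝ 𝔤] in
lemma formInChart_bijective {u v : G} (hv : v ∈ (extChartAt 𝓘(ℝ, EG) u).source) :
    Function.Bijective (formInChart C.form u (extChartAt 𝓘(ℝ, EG) u v)) := by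
  rw [formInChart_extChartAt C.form hv]
  have h : Function.Bijective (chartSymmDeriv u (extChartAt 𝓘(ℝ, EG) u v)) :=
    Function.bijective_iff_has_inverse.mpr ⟨chartDeriv u v,
      fun b => congrArg (fun f : EG →L[ℝ] EG => f b) (chartDeriv_comp_chartSymmDeriv hv),
      fun b => congrArg (fun f : EG →L[ℝ] EG => f b) (chartSymmDeriv_comp_chartDeriv hv)⟩
  exact (C.bijective v).comp h

/-- The curvature function at `v` as a continuous bilinear map. -/
def curvatureCLM (v : G) : 𝔤 →L[ℝ] 𝔤 →L[ℝ] 𝔤 :=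
  LinearMap.toContinuousBilinearMap (altToBilin (C.curvatureFunction v))

-- Order `2` suffices for the Bianchi identity, and unlike order `∞` this finite order passes from a
-- point to a neighbourhood.
omit [FiniteDimensional ℝ 𝔤] in
lemma contDiffAt_form (u : G) :
    ContDiffAt ℝ 2 (formInChart C.form u) (extChartAt 𝓘(ℝ, EG) u u) :=
  (contDiffAt_formInChart u (C.smooth u)).of_le (WithTop.coe_le_coe.mpr (le_top : (2 : ℕ∞) ≤ ⊤))

variable (𝔤) in
/-- The Lie bracket as a continuous bilinear map. -/
def bracketCLM : 𝔤 →L[ℝ] 𝔤 →L[ℝ] 𝔤 :=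
  LinearMap.toContinuousBilinearMap (LieModule.toEnd ℝ 𝔤 𝔤 : 𝔤 →ₗ[ℝ] 𝔤 →ₗ[ℝ] 𝔤)

lemma bracketCLM_apply (X Y : 𝔤) : bracketCLM 𝔤 X Y = ⁅X, Y⁆ := rfl

lemma eventually_curvatureCLM_eq (u : G) :
    ∀ᶠ z in 𝓝 (extChartAt 𝓘(ℝ, EG) u u), ∀ b c,
      fderiv ℝ (formInChart C.form u) z b c - fderiv ℝ (formInChart C.form u) z c b +
        bracketCLM 𝔤 (formInChart C.form u z b) (formInChart C.form u z c) =
      C.curvatureCLM ((extChartAt 𝓘(ℝ, EG) u).symm z) (formInChart C.form u z b)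
        (formInChart C.form u z c) := by
  have h2 := (contDiffAt_form C u).eventually (by decide)
  filter_upwards [extChartAt_target_mem_nhds (I := 𝓘(ℝ, EG)) u, h2] with z hz hdz b c
  have h := C.curvatureFunction_formInChart ((extChartAt 𝓘(ℝ, EG) u).map_target hz)
    (by rw [(extChartAt 𝓘(ℝ, EG) u).right_inv hz]; exact hdz.differentiableAt (by norm_num)) b c
  rw [(extChartAt 𝓘(ℝ, EG) u).right_inv hz] at h
  exact h.symm

variable [FiniteDimensional ℝ EG]

/-- Solving the structure equation for `κ` gives `κ(X, Y) = dθ(θ⁻¹X, θ⁻¹Y) + [X, Y]` in the chart.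
Here `dθ` is differentiable because `θ` is `C²`, and `θ⁻¹` because inversion of linear isomorphisms
is smooth. -/
lemma differentiableAt_curvatureCLM (u : G) :
    DifferentiableAt ℝ (fun z => C.curvatureCLM ((extChartAt 𝓘(ℝ, EG) u).symm z))
      (extChartAt 𝓘(ℝ, EG) u u) := by
  set θ := formInChart C.form u
  set z₀ := extChartAt 𝓘(ℝ, EG) u u
  have hθ := contDiffAt_form C u
  have hbij : ∀ᶠ z in 𝓝 z₀, Function.Bijective (θ z) := by
    filter_upwards [extChartAt_target_mem_nhds (I := 𝓘(ℝ, EG)) u] with z hz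
    have := C.formInChart_bijective ((extChartAt 𝓘(ℝ, EG) u).map_target hz)
    rwa [(extChartAt 𝓘(ℝ, EG) u).right_inv hz] at this
  have hequiv : ∀ z, Function.Bijective (θ z) → ∃ e : EG ≃L[ℝ] 𝔤, (e : EG →L[ℝ] 𝔤) = θ z :=
    fun z hz => ⟨(LinearEquiv.ofBijective (θ z : EG →ₗ[ℝ] 𝔤) hz).toContinuousLinearEquiv,
      by ext; rfl⟩
  have hθ1 : DifferentiableAt ℝ θ z₀ := hθ.differentiableAt (by norm_num)
  have hθ2 : DifferentiableAt ℝ (fderiv ℝ θ) z₀ :=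
    (hθ.fderiv_right (m := 1) (by norm_num)).differentiableAt (by norm_num)
  have hinv : DifferentiableAt ℝ (fun z => ContinuousLinearMap.inverse (θ z)) z₀ := by
    obtain ⟨e, he⟩ := hequiv z₀ hbij.self_of_nhds
    have := (contDiffAt_map_inverse (𝕜 := ℝ) (n := 1) e).differentiableAt (by norm_num)
    rw [he] at this
    exact this.comp z₀ hθ1
  refine differentiableAt_of_apply fun X => differentiableAt_of_apply fun Y => ?_
  have hX := hinv.clm_apply (differentiableAt_const X)
  have hY := hinv.clm_apply (differentiableAt_const Y)
  have hd : DifferentiableAt ℝ (fun z =>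
      fderiv ℝ θ z ((θ z).inverse X) ((θ z).inverse Y) -
        fderiv ℝ θ z ((θ z).inverse Y) ((θ z).inverse X) + bracketCLM 𝔤 X Y) z₀ :=
    (((hθ2.clm_apply hX).clm_apply hY).sub ((hθ2.clm_apply hY).clm_apply hX)).add
      (differentiableAt_const _)
  refine hd.congr_of_eventuallyEq ?_
  filter_upwards [hbij, C.eventually_curvatureCLM_eq u] with z hz hK
  obtain ⟨e, he⟩ := hequiv z hz
  have hr : ∀ X, θ z ((θ z).inverse X) = X := fun X => by
    rw [← he, ContinuousLinearMap.inverse_equiv]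
    exact e.apply_symm_apply X
  have h := hK ((θ z).inverse X) ((θ z).inverse Y)
  change _ + bracketCLM 𝔤 (θ z _) (θ z _) = C.curvatureCLM _ (θ z _) (θ z _) at h
  rw [hr, hr] at h
  exact h.symm

/-- The Bianchi identity for the curvature function. Here `D X` is the derivative of the curvature
function at `u` in direction `ω_u⁻¹(X)`. -/
lemma exists_bianchi (u : G) : ∃ D : 𝔤 → 𝔤 →L[ℝ] 𝔤 →L[ℝ] 𝔤,
    (∀ (W : Submodule ℝ 𝔤) (Y Z : 𝔤), (∀ v, C.curvatureCLM v Y Z ∈ W) → ∀ X, D X Y Z ∈ W) ∧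
    ∀ X Y Z, D X Y Z + D Y Z X + D Z X Y =
      ⁅C.curvatureCLM u X Y, Z⁆ + ⁅C.curvatureCLM u Y Z, X⁆ + ⁅C.curvatureCLM u Z X, Y⁆ -
      (C.curvatureCLM u (C.curvatureCLM u X Y) Z + C.curvatureCLM u (C.curvatureCLM u Y Z) X +
        C.curvatureCLM u (C.curvatureCLM u Z X) Y) +
      (C.curvatureCLM u ⁅X, Y⁆ Z + C.curvatureCLM u ⁅Y, Z⁆ X + C.curvatureCLM u ⁅Z, X⁆ Y) := by
  have hκ := C.differentiableAt_curvatureCLM u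
  have hbij := C.formInChart_bijective (mem_extChartAt_source (I := 𝓘(ℝ, EG)) u)
  -- `inv X` is `ω_u⁻¹(X)` in the coordinates of the chart at `u`.
  choose inv hinv using hbij.2
  refine ⟨fun X => fderiv ℝ (fun z => C.curvatureCLM ((extChartAt 𝓘(ℝ, EG) u).symm z))
    (extChartAt 𝓘(ℝ, EG) u u) (inv X), fun W Y Z hW X => ?_, fun X Y Z => ?_⟩
  · have hYZ := (hκ.clm_apply (differentiableAt_const Y)).clm_apply (differentiableAt_const Z)
    have := fderiv_apply_mem_of_eventually_mem hYZ W (.of_forall fun z => hW _) (inv X)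
    rw [fderiv_clm_apply (hκ.clm_apply (differentiableAt_const Y)) (differentiableAt_const Z),
      fderiv_clm_apply hκ (differentiableAt_const Y)] at this
    simpa using this
  · have h := bianchi_of_curvature_eq (bracketCLM 𝔤) (fun x y => (lie_skew x y).symm)
      (fun x y z => by
        simp only [bracketCLM_apply]
        rw [← lie_skew ⁅x, y⁆ z, ← lie_skew ⁅y, z⁆ x, ← lie_skew ⁅z, x⁆ y, ← neg_add, ← neg_add, neg_eq_zero,
          ← lie_jacobi z x y])
      (contDiffAt_form C u) hκ (C.eventually_curvatureCLM_eq u)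
      (fun x z => alt_skew (C.curvatureFunction _) x z) (inv X) (inv Y) (inv Z)
    simp only [hinv, extChartAt_to_inv, bracketCLM_apply] at h
    exact h

variable {C} in
/-- If all values of the curvature function are homogeneous of degree `≥ ℓ` for some `ℓ > 0`, then
their `gr_ℓ` is a cocycle. -/
lemma grMap_curvatureFunction_mem_twoCocycle {ℓ : ℤ} (hℓ : 0 < ℓ)
    (h : ∀ v, C.curvatureFunction v ∈ A.horCochainGE ℓ) (u : G) :
    A.grMap ℓ ⟨C.curvatureFunction u, h u⟩ ∈ twoCocycle ℝ A.negPart A.Gr := by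
  refine LieFiltration.grMap_mem_twoCocycle _ fun i hi j hj k hk X hX Y hY Z hZ => ?_
  obtain ⟨D, hD, hB⟩ := C.exists_bianchi u
  have hmem : ∀ v i j X Y, X ∈ A.F i → Y ∈ A.F j → C.curvatureCLM v X Y ∈ A.F (i + j + ℓ) :=
    fun v => LieFiltration.horCochainGE_mem (h v)
  -- The derivative stays in `𝔤^{j+k+ℓ}`, and `i ≤ -1` supplies the extra degree.
  have hD' : ∀ i j k X Y Z, i < 0 → Y ∈ A.F j → Z ∈ A.F k → D X Y Z ∈ A.F (i + j + k + ℓ + 1) :=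
    fun i j k X Y Z hi hY hZ => A.anti (by omega : _ ≤ j + k + ℓ)
      (hD _ Y Z (fun v => hmem v j k Y Z hY hZ) X)
  -- Two applications of `κ` raise the degree by `2ℓ ≥ ℓ + 1`; this is where `ℓ > 0` enters.
  have hκκ : ∀ i j k X Y Z, X ∈ A.F i → Y ∈ A.F j → Z ∈ A.F k →
      C.curvatureCLM u (C.curvatureCLM u X Y) Z ∈ A.F (i + j + k + ℓ + 1) :=
    fun i j k X Y Z hX hY hZ => A.anti (by omega : _ ≤ i + j + ℓ + k + ℓ)
      (hmem u _ _ _ _ (hmem u _ _ _ _ hX hY) hZ)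
  have e1 : j + k + i + ℓ + 1 = i + j + k + ℓ + 1 := by ring
  have e2 : k + i + j + ℓ + 1 = i + j + k + ℓ + 1 := by ring
  have hsum := add_mem
    (add_mem (add_mem (hD' i j k X Y Z hi hY hZ) (e1 ▸ hD' j k i Y Z X hj hZ hX))
      (e2 ▸ hD' k i j Z X Y hk hX hY))
    (add_mem (add_mem (hκκ i j k X Y Z hX hY hZ) (e1 ▸ hκκ j k i Y Z X hY hZ hX))
      (e2 ▸ hκκ k i j Z X Y hZ hX hY))
  -- Substituting the Bianchi identity for the derivatives cancels the terms quadratic in `κ` and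
  -- leaves the cyclic sum of the cocycle criterion.
  rw [hB X Y Z] at hsum
  convert hsum using 1
  have e : ∀ X Y, altToBilin (C.curvatureFunction u) X Y = C.curvatureCLM u X Y := fun _ _ => rfl
  simp only [e]
  abel

end CartanConnection

end

/-! ### Induction on the homogeneity degree -/

theorem proposition4p3
    {𝔤 : Type*} [NormedAddCommGroup 𝔤] [NormedSpace ℝ 𝔤] [FiniteDimensional ℝ 𝔤] [LieBracketOn 𝔤]
    {EP : Type*} [NormedAddCommGroup EP] [NormedSpace ℝ EP] [FiniteDimensional ℝ EP]
    {P : Type*} [TopologicalSpace P] [ChartedSpace EP P] [Group P] [LieGroup 𝓘(ℝ, EP) ∞ P]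
    {EG : Type*} [NormedAddCommGroup EG] [NormedSpace ℝ EG] [FiniteDimensional ℝ EG]
    {G : Type*} [TopologicalSpace G] [ChartedSpace EG G] [IsManifold 𝓘(ℝ, EG) ∞ G]
    {EM : Type*} [NormedAddCommGroup EM] [NormedSpace ℝ EM] [FiniteDimensional ℝ EM]
    {M : Type*} [TopologicalSpace M] [ChartedSpace EM M] [IsManifold 𝓘(ℝ, EM) ∞ M]
    (A : AdmissiblePair 𝔤 P (EP := EP))
    (N N' : Submodule ℝ (𝔤 [⋀^Fin 2]→ₗ[ℝ] 𝔤))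
    (hN : A.IsNormalizationCondition N) (hN' : A.IsNegligible N N')
    (B : PrincipalBundle P G M (EP := EP) (EG := EG) (EM := EM))
    (C : CartanConnection A B) (hreg : C.IsRegular) (hnorm : C.IsNormal N) :
    (∀ u : G, C.essentialCurvature hnorm N' u = 0) ↔
      ∀ (u : G) (ξ η : TangentSpace 𝓘(ℝ, EG) u), C.curvature u ξ η = 0 := by
  constructor
  · intro h
    have hmem : ∀ u, C.curvatureFunction u ∈ N' := fun u =>
      (Submodule.Quotient.mk_eq_zero (N'.submoduleOf N)).mp (h u)
    -- The claim is made for all `u` at once, since the inductive step differentiates `κ`. The shift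
    -- by one makes regularity the base case.
    have hGE : ∀ n : ℕ, ∀ u, C.curvatureFunction u ∈ A.horCochainGE ((n : ℤ) + 1) := by
      intro n
      induction n with
      | zero =>
        refine fun u => ⟨hN.le_hor (hnorm u), fun i _ j _ X hX Y hY => ?_⟩
        rw [C.curvatureFunction_apply, Nat.cast_zero, zero_add]
        have hform : ∀ X, C.form u ((C.iso u).symm X) = X := (C.iso u).apply_symm_apply
        exact hreg u _ _ i j ((hform X).symm ▸ hX) ((hform Y).symm ▸ hY)
      | succ n ih =>
        intro u
        have hℓ : (0 : ℤ) < (n : ℤ) + 1 := by omega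
        -- The leading part lies both in `gr_ℓ` of the negligible submodule and in the kernel of the
        -- differential.
        have hzero : A.grMap ((n : ℤ) + 1) ⟨C.curvatureFunction u, ih u⟩ = 0 := by
          rw [← Submodule.mem_bot ℝ, ← hN'.disjoint _ hℓ]
          exact ⟨Submodule.mem_map_of_mem (hmem u),
            CartanConnection.grMap_curvatureFunction_mem_twoCocycle hℓ ih u⟩
        exact_mod_cast LieFiltration.mem_horCochainGE_succ_of_grMap_eq_zero hzero
    intro u ξ η
    -- For `n = 2μ + ν + 2` the degree `n + 1` is the bound beyond which horizontal cochains vanish.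
    have h0 := LieFiltration.horCochainGE_eq_zero (by push_cast; omega)
      (hGE (2 * A.μ + A.ν + 2) u) (C.iso u ξ) (C.iso u η)
    rwa [C.curvatureFunction_apply, LinearEquiv.symm_apply_apply,
      LinearEquiv.symm_apply_apply] at h0
  · intro h u
    refine (Submodule.Quotient.mk_eq_zero _).mpr ?_
    have h0 : C.curvatureFunction u = 0 := AlternatingMap.ext fun v => h u _ _
    change C.curvatureFunction u ∈ N'
    rw [h0]
    exact zero_mem _
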